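/- Let $G=\mathrm{SL}_3(\mathbb Z)$ with the Steinberg presentation on the six generators $E_{i,j}$ ($i\neq j$ in $\{1,2,3\}$; in $G$, $E_{i,j}$ is the elementary matrix with entry $1$ in position $(i,j)$). With $[a,b]=aba^{-1}b^{-1}$, the relators are $$[E_{i,j},E_{i,k}],\qquad [E_{i,k},E_{j,k}],\qquad [E_{i,j},E_{j,k}]E_{i,k}^{-1}$$ for all ordered triples $(i,j,k)$ of distinct indices, together with $(E_{1,2}E_{2,1}^{-1}E_{1,2})^4$. Let $d_0$ be the column with entries $1-s$, indexed by the generators $s$, and let $d_1=[\partial r/\partial s]$ be the Jacobian matrix over $\mathbb R G$, indexed by the relators $r$ and the generators $s$. Here the Fox derivatives are defined by $\partial e/\partial s=0$, $\partial t/\partial s=\delta_{s,t}$ for generators $s,t$, and $\partial(uv)/\partial s=\partial u/\partial s+u\,\partial v/\partial s$, and are mapped to $\mathbb R G$. Let $*$ be the conjugate transpose with respect to the involution $g\mapsto g^{-1}$ of $\mathbb R G$, and put $$\Delta_1=d_0d_0^*+d_1^*d_1\in \mathrm{Mat}_6(\mathbb R G),$$ the degree-$1$ cohomological Laplacian of the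 presentation complex. Then there is a real number $\lambda>0$, with $\lambda\geqslant 0.32$, such that $\Delta_1-\lambda I$ is a sum of hermitian squares: $\Delta_1-\lambda I=\sum_{i=1}^k M_i^*M_i$ for some $k\in\mathbb N$ and $M_1,\dots,M_k\in\mathrm{Mat}_6(\mathbb R G)$. Moreover, for every unitary representation $\pi\colon G\to U(\mathcal H)$ on a complex Hilbert space, the operator $\pi(\Delta_1)$ on $\mathcal H^{6}$, with $(\pi(\Delta_1)x)_s=\sum_t\pi((\Delta_1)_{s,t})x_t$, is invertible and has spectral gap at least $\lambda$, i.e. its spectrum is contained in $[\lambda,\infty)$. -/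

import Mathlib

open scoped Matrix

noncomputable section

namespace FoxLaplacian

/-! ### The real group ring as a star ring -/

section GroupRing

variable {G : Type*} [Group G]

/-- The involution of the real group ring: the real-linear extension of `g ↦ g⁻¹`. -/
instance instStarMonoidAlgebra : Star (MonoidAlgebra ℝ G) where
  star x := MonoidAlgebra.mapDomain (fun g : G => g⁻¹) x

theorem star_def (x : MonoidAlgebra ℝ G) :
    star x = MonoidAlgebra.mapDomain (fun g : G => g⁻¹) x := rfl

theorem star_single (g : G) (r : ℝ) :
    star (MonoidAlgebra.single g r) = MonoidAlgebra.single g⁻¹ r := by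
  simp [star_def]

theorem star_add_aux (x y : MonoidAlgebra ℝ G) : star (x + y) = star x + star y := by
  simp [star_def, MonoidAlgebra.mapDomain_add]

instance instStarRingMonoidAlgebra : StarRing (MonoidAlgebra ℝ G) where
  star_involutive x := by
    induction x using MonoidAlgebra.induction_linear with
    | zero => simp [star_def]
    | add x y hx hy => rw [star_add_aux, star_add_aux, hx, hy]
    | single g r => rw [star_single, star_single, inv_inv]
  star_add := star_add_aux
  star_mul x y := by
    induction x using MonoidAlgebra.induction_linear with
    | zero => simp [star_def]
    | add x x' hx hx' => rw [add_mul, star_add_aux, hx, hx', star_add_aux, mul_add]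
    | single g r =>
      induction y using MonoidAlgebra.induction_linear with
      | zero => simp [star_def]
      | add y y' hy hy' => rw [mul_add, star_add_aux, hy, hy', star_add_aux, add_mul]
      | single h s =>
        rw [MonoidAlgebra.single_mul_single, star_single, star_single, star_single,
          MonoidAlgebra.single_mul_single, mul_inv_rev, mul_comm r s]

/-- `A` is a sum of hermitian squares `M₁ᴴ M₁ + ⋯ + Mₖᴴ Mₖ` of matrices over the group ring. -/
def IsSumOfHermitianSquares {n : Type*} [Fintype n] (A : Matrix n n (MonoidAlgebra ℝ G)) : Prop :=
  ∃ (k : ℕ) (M : Fin k → Matrix n n (MonoidAlgebra ℝ G)), A = ∑ i, (M i)ᴴ * M i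

end GroupRing

/-! ### Fox calculus -/

section Fox

variable {S : Type*} [DecidableEq S]

/-- The free group acting on its real group ring by left multiplication, in multiplicative
notation. -/
def leftMulAut (S : Type*) :
    FreeGroup S →* MulAut (Multiplicative (MonoidAlgebra ℝ (FreeGroup S))) :=
  (MulAutMultiplicative (MonoidAlgebra ℝ (FreeGroup S))).symm.toMonoidHom.comp
    ((DistribMulAction.toAddAut (MonoidAlgebra ℝ (FreeGroup S))ˣ
      (MonoidAlgebra ℝ (FreeGroup S))).comp
        (MonoidAlgebra.of ℝ (FreeGroup S)).toHomUnits)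

/-- The homomorphism `w ↦ (∂w/∂s, w)` from the free group to the semidirect product of its
group ring with itself, determined by `t ↦ (δ_{t,s}, t)` on generators. -/
def foxHom (s : S) :
    FreeGroup S →*
      Multiplicative (MonoidAlgebra ℝ (FreeGroup S)) ⋊[leftMulAut S] FreeGroup S :=
  FreeGroup.lift fun t => ⟨Multiplicative.ofAdd (if t = s then 1 else 0), FreeGroup.of t⟩

/-- The Fox derivative `∂w/∂s`, an element of the real group ring of the free group. It is the
unique map with the properties `foxDeriv_one`, `foxDeriv_of`, `foxDeriv_mul`. -/
def foxDeriv (s : S) (w : FreeGroup S) : MonoidAlgebra ℝ (FreeGroup S) :=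
  Multiplicative.toAdd (foxHom s w).left

theorem foxHom_right (s : S) (w : FreeGroup S) : (foxHom s w).right = w := by
  have h : (SemidirectProduct.rightHom.comp (foxHom s)) = MonoidHom.id (FreeGroup S) := by
    ext t
    simp [foxHom]
  exact DFunLike.congr_fun h w

theorem foxDeriv_one (s : S) : foxDeriv s 1 = 0 := by
  simp [foxDeriv]

theorem foxDeriv_of (s t : S) : foxDeriv s (FreeGroup.of t) = if t = s then 1 else 0 := by
  simp [foxDeriv, foxHom]

theorem foxDeriv_mul (s : S) (u v : FreeGroup S) :
    foxDeriv s (u * v) = foxDeriv s u + MonoidAlgebra.of ℝ (FreeGroup S) u * foxDeriv s v := by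
  simp only [foxDeriv, map_mul, SemidirectProduct.mul_left, foxHom_right, toAdd_mul]
  rfl

end Fox

/-! ### The cohomological Laplacian in degree one of a presentation

A presentation of `G` is given by its generators `gen : S → G` and its relators
`rel : R → FreeGroup S`. -/

section Laplacian

variable {G S R : Type*} [Group G] [DecidableEq S]

/-- The codifferential `d₀`: the column with entries `1 - s`. -/
def d₀ (gen : S → G) : Matrix S Unit (MonoidAlgebra ℝ G) :=
  Matrix.of fun s _ => 1 - MonoidAlgebra.of ℝ G (gen s)

/-- The Jacobian `d₁ = [∂r/∂s]`, with the Fox derivatives mapped to the group ring of `G`. -/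
def d₁ (gen : S → G) (rel : R → FreeGroup S) : Matrix R S (MonoidAlgebra ℝ G) :=
  Matrix.of fun r s =>
    MonoidAlgebra.mapDomainRingHom ℝ (FreeGroup.lift gen) (foxDeriv s (rel r))

/-- The cohomological Laplacian `Δ₁ = d₀ d₀* + d₁* d₁`. -/
def laplacian₁ [Fintype R] (gen : S → G) (rel : R → FreeGroup S) :
    Matrix S S (MonoidAlgebra ℝ G) :=
  d₀ gen * (d₀ gen)ᴴ + (d₁ gen rel)ᴴ * d₁ gen rel

end Laplacian

/-! ### The Steinberg presentation of `SL₃(ℤ)` -/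

/-- The ordered pairs `(i, j)` with `i ≠ j`, indexing the six elementary matrices. -/
abbrev Pairs : Type := {p : Fin 3 × Fin 3 // p.1 ≠ p.2}

/-- The ordered triples `(i, j, k)` of distinct indices. -/
abbrev Triples : Type :=
  {t : Fin 3 × Fin 3 × Fin 3 // t.1 ≠ t.2.1 ∧ t.2.1 ≠ t.2.2 ∧ t.1 ≠ t.2.2}

/-- The elementary matrix `E_{i,j}` in `SL₃(ℤ)`. -/
def elementary (p : Pairs) : Matrix.SpecialLinearGroup (Fin 3) ℤ :=
  Matrix.SpecialLinearGroup.transvection p.2 1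

/-- The free generator with name `E_{i,j}`. -/
def E (i j : Fin 3) (h : i ≠ j) : FreeGroup Pairs := FreeGroup.of ⟨(i, j), h⟩

open scoped commutatorElement in
/-- The relators of the Steinberg presentation, where `⁅a, b⁆ = a * b * a⁻¹ * b⁻¹`: for distinct
`i, j, k` the words `⁅E_{i,j}, E_{i,k}⁆`, `⁅E_{i,k}, E_{j,k}⁆` and
`⁅E_{i,j}, E_{j,k}⁆ * E_{i,k}⁻¹`, and the word `(E_{1,2} * E_{2,1}⁻¹ * E_{1,2}) ^ 4`. -/
def steinbergRelator : Triples ⊕ Triples ⊕ Triples ⊕ Unit → FreeGroup Pairs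
  | .inl ⟨(i, j, k), h⟩ => ⁅E i j h.1, E i k h.2.2⁆
  | .inr (.inl ⟨(i, j, k), h⟩) => ⁅E i k h.2.2, E j k h.2.1⁆
  | .inr (.inr (.inl ⟨(i, j, k), h⟩)) => ⁅E i j h.1, E j k h.2.1⁆ * (E i k h.2.2)⁻¹
  | .inr (.inr (.inr _)) => (E 0 1 (by decide) * (E 1 0 (by decide))⁻¹ * E 0 1 (by decide)) ^ 4

/-- The cohomological Laplacian in degree one of the presentation complex of `SL₃(ℤ)`, a
`6 × 6` matrix over the real group ring. -/
def steinbergLaplacian :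
    Matrix Pairs Pairs (MonoidAlgebra ℝ (Matrix.SpecialLinearGroup (Fin 3) ℤ)) :=
  laplacian₁ elementary steinbergRelator

/-! ### Matrices over the group ring acting through a unitary representation -/

section Representation

variable {G H n : Type*} [Group G] [NormedAddCommGroup H] [InnerProductSpace ℂ H]
  [CompleteSpace H] [Fintype n]

/-- The extension of a unitary representation to the real group ring. -/
def repAlgHom (π : G →* unitary (H →L[ℂ] H)) : MonoidAlgebra ℝ G →ₐ[ℝ] (H →L[ℂ] H) :=
  MonoidAlgebra.lift ℝ (H →L[ℂ] H) G ((unitary (H →L[ℂ] H)).subtype.comp π)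

/-- The operator `π(A)` on the Hilbert space `Hⁿ`, given by
`(π(A) x)ᵢ = ∑ⱼ π(Aᵢⱼ) xⱼ`. -/
def repMatrix (π : G →* unitary (H →L[ℂ] H)) (A : Matrix n n (MonoidAlgebra ℝ G)) :
    PiLp 2 (fun _ : n => H) →L[ℂ] PiLp 2 (fun _ : n => H) :=
  (PiLp.continuousLinearEquiv 2 ℂ (fun _ : n => H)).symm.toContinuousLinearMap ∘L
    ContinuousLinearMap.pi fun i =>
      ∑ j, repAlgHom π (A i j) ∘L PiLp.proj 2 (fun _ : n => H) j

end Representation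

end FoxLaplacian

end

/-! The theorem is proved by an explicit certificate: a sum of squares close to `Δ₁ - 1.32`, with an
error that costs at most `1`. Symmetry makes the certificate small, an `ℓ¹` estimate makes it
tolerant of rounding, and packing makes it checkable in exact integer arithmetic.

Symmetry. The group `S₃` of coordinate permutations acts on `SL₃(ℤ)`, and it acts simply
transitively on the six generators and on each of the three families of six commutator relators.
Indexing rows and columns by `S₃`, the equivariant `6 × 6` matrices are the images of elements of
the group ring of `SL₃(ℤ) ⋊ S₃` under the `*`-homomorphism `crossedRep`. The relator `(E₁₂ E₂₁⁻¹
E₁₂) ^ 4` breaks the symmetry, but its contribution to `d₁* d₁` is itself a hermitian square and can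
be set aside. The rest of `Δ₁` is the image of one element, `reducedLaplacian`
(`laplacian_submatrix`), so it suffices to write `reducedLaplacian - 0.32` as a sum of squares.

Error. For a group element `g` and real `c`, `2|c| + c (g + g⁻¹)` equals `|c| (1 ± g)* (1 ± g)`.
Hence if `r = r*` has `ℓ¹`-norm at most `n`, then `n + r` is a sum of hermitian squares
(`add_smul_one_mem_hermitianSquares`). The certificate consists of 32 elements with integer
coefficients, supported on products of the 6 permutations with 61 matrices. Let `r` be `10¹⁰
(reducedLaplacian - 1.32)` minus the sum of their squares. Then `r` has `ℓ¹`-norm at most `10¹⁰`,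
and `10¹⁰ (reducedLaplacian - 0.32)` is the sum of these squares plus `10¹⁰ + r`.

Verification. The kernel computes `r` exactly. Group elements are encoded as integers, so that
multiplying them is a dot product of four integers (`intKey_sandwich`), and the Gram coefficients
are obtained many at a time as digits of very long integers (`adds_subtractSquares`). The only
numerical fact is `certificateCheck_eq_true`.

The spectral statement follows because a unitary representation sends hermitian squares of matrices
to positive operators on `Hⁿ` (`repMatrix_spectrum`). -/

noncomputable section

namespace FoxLaplacian

/-! ### Evaluation of large integer sums in the kernel

The functions of this section are written with recursors and in continuation-passing style, so that
they evaluate quickly and without building up unevaluated terms. -/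

section Evaluation

variable {α ι κ T : Type}

/-- Apply `f` to `n` after `n` has been evaluated. -/
def forceNat (n : ℕ) (f : ℕ → α) : α :=
  Nat.rec (f 0) (fun m _ => f (m + 1)) n

/-- Apply `f` to `z` after `z` has been evaluated. -/
def forceInt (z : ℤ) (f : ℤ → α) : α :=
  Int.rec (fun n => forceNat n fun m => f (Int.ofNat m))
    (fun n => forceNat n fun m => f (Int.negSucc m)) z

theorem forceNat_eq (n : ℕ) (f : ℕ → α) : forceNat n f = f n := by
  cases n <;> rfl

theorem forceInt_eq (z : ℤ) (f : ℤ → α) : forceInt z f = f z := by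
  cases z with
  | ofNat n => exact forceNat_eq n fun m => f (Int.ofNat m)
  | negSucc n => exact forceNat_eq n fun m => f (Int.negSucc m)

/-- Map `f` over a list, where `f` passes its result on to a continuation. -/
def mapCont (f : ι → (κ → α) → α) (l : List ι) : (List κ → α) → α :=
  List.rec (fun k => k []) (fun x _ ih k => f x fun y => ih fun ys => k (y :: ys)) l

theorem mapCont_eq {f : ι → (κ → α) → α} {g : ι → κ} (h : ∀ x k, f x k = k (g x)) (l : List ι)
    (k : List κ → α) : mapCont f l k = k (l.map g) := by
  induction l generalizing k with
  | nil => rfl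
  | cons x l ih =>
    change f x (fun y => mapCont f l fun ys => k (y :: ys)) = _
    rw [h, ih, List.map_cons]

/-! ### Balanced digits of integers. -/

/-- The last balanced digit of `z` in base `b`. -/
def digit (b z : ℤ) : ℤ := (z + b / 2) % b - b / 2

/-- The integer `z` without its last balanced digit in base `b`. -/
def shift (b z : ℤ) : ℤ := (z + b / 2) / b

/-- The balanced digits of `z` in base `b`, by position. -/
def digitAt (b z : ℤ) (k : ℕ) : ℤ := digit b ((shift b)^[k] z)

theorem abs_digit_le {b : ℤ} (hb : 0 < b) (z : ℤ) : 2 * |digit b z| ≤ b := by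
  have h1 := Int.emod_nonneg (z + b / 2) hb.ne'
  have h2 := Int.emod_lt_of_pos (z + b / 2) hb
  rcases abs_cases (digit b z) with ⟨h, -⟩ | ⟨h, -⟩ <;> rw [h] <;> unfold digit <;> omega

/-- The bound places `d + b / 2` in `[0, b)`, so it is the remainder of `d + b / 2 + b * z` modulo
`b`, and `z` is the quotient. -/
theorem digit_add_mul {b d : ℤ} (hd : 2 * |d| + 1 ≤ b) (z : ℤ) : digit b (d + b * z) = d := by
  have h := abs_le.1 (le_refl |d|)
  rw [digit, show d + b * z + b / 2 = d + b / 2 + b * z by ring, Int.add_mul_emod_self_left,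
    Int.emod_eq_of_lt] <;> omega

theorem shift_add_mul {b d : ℤ} (hd : 2 * |d| + 1 ≤ b) (z : ℤ) : shift b (d + b * z) = z := by
  have h := abs_le.1 (le_refl |d|)
  rw [shift, show d + b * z + b / 2 = d + b / 2 + b * z by ring,
    Int.add_mul_ediv_left _ _ (by omega), Int.ediv_eq_zero_of_lt, zero_add] <;> omega

theorem sum_pow_succ (b : ℤ) (d : ℕ → ℤ) (n : ℕ) :
    ∑ k ∈ Finset.range (n + 1), d k * b ^ k =
      d 0 + b * ∑ k ∈ Finset.range n, d (k + 1) * b ^ k := by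
  rw [Finset.sum_range_succ', Finset.mul_sum, add_comm]
  congr 1
  · simp
  · exact Finset.sum_congr rfl fun k _ => by ring

/-- Packing can be nested: a block of `n` admissible digits in base `b` is an admissible digit in
base `b ^ n`. This is what allows six blocks of 61 coefficients each to sit in one integer. -/
theorem abs_sum_pow_le {b : ℤ} {d : ℕ → ℤ} {n : ℕ} (h : ∀ k < n, 2 * |d k| + 1 ≤ b) :
    2 * |∑ k ∈ Finset.range n, d k * b ^ k| + 1 ≤ b ^ n := by
  induction n generalizing d with
  | zero => simp
  | succ n ih =>
    have h1 := ih (d := fun k => d (k + 1)) fun k hk => h (k + 1) (by omega)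
    have h0 := h 0 (by omega)
    rw [sum_pow_succ]
    set s := ∑ k ∈ Finset.range n, d (k + 1) * b ^ k
    have hb : 0 < b := by have := abs_nonneg (d 0); omega
    have h2 : |d 0 + b * s| ≤ |d 0| + b * |s| := by
      simpa [abs_mul, abs_of_pos hb] using abs_add_le (d 0) (b * s)
    have h3 : b * (2 * |s| + 1) ≤ b * b ^ n := mul_le_mul_of_nonneg_left h1 hb.le
    rw [pow_succ']
    linarith

/-- Read the first `n` balanced digits of `z` in base `b` as digits in base `c`. -/
def rebase (b c : ℤ) (n : ℕ) : ℤ → (ℤ → α) → α :=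
  Nat.rec (fun _ k => k 0)
    (fun _ ih z k => forceInt (digit b z) fun d => forceInt (shift b z) fun z' =>
      ih z' fun x => forceInt (d + c * x) k) n

theorem rebase_eq (b c : ℤ) (n : ℕ) (z : ℤ) (k : ℤ → α) :
    rebase b c n z k = k (∑ j ∈ Finset.range n, digitAt b z j * c ^ j) := by
  induction n generalizing z k with
  | zero => rfl
  | succ n ih =>
    change forceInt (digit b z) (fun d => forceInt (shift b z) fun z' =>
      rebase b c n z' fun x => forceInt (d + c * x) k) = _
    rw [forceInt_eq, forceInt_eq, ih, forceInt_eq, sum_pow_succ]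
    rfl

/-! ### Computations that accumulate terms in a state. -/

/-- The step `F`, with a continuation, changes the value of the state by `w`. -/
def Adds {A : Type*} [Add A] (val : T → A) (F : T → (T → α) → α) (w : A) : Prop :=
  ∀ t k, ∃ t', F t k = k t' ∧ val t' = val t + w

/-- Run `f` on the items of a list. -/
def foldCont (f : ι → T → (T → α) → α) (l : List ι) : T → (T → α) → α :=
  List.rec (fun t k => k t) (fun x _ ih t k => f x t fun t' => ih t' k) l

theorem Adds.foldCont {A : Type*} [AddMonoid A] {val : T → A} {f : ι → T → (T → α) → α}
    {w : ι → A} (l : List ι) (h : ∀ x ∈ l, Adds val (f x) (w x)) :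
    Adds val (foldCont f l) (l.map w).sum := by
  induction l with
  | nil => exact fun t k => ⟨t, rfl, by simp⟩
  | cons x l ih =>
    intro t k
    obtain ⟨t₁, h₁, e₁⟩ := h x (by simp) t fun t' => FoxLaplacian.foldCont f l t' k
    obtain ⟨t₂, h₂, e₂⟩ := ih (fun y hy => h y (by simp [hy])) t₁ k
    exact ⟨t₂, h₁.trans h₂, by rw [e₂, e₁, List.map_cons, List.sum_cons, add_assoc]⟩

/-- Run `f` on the items of a list paired with the successive balanced digits of an integer. -/
def digitFold (b : ℤ) (f : ι → ℤ → T → (T → α) → α) (l : List ι) :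
    ℤ → T → (T → α) → α :=
  List.rec (fun _ t k => k t)
    (fun x _ ih z t k => forceInt (digit b z) fun d => forceInt (shift b z) fun z' =>
      f x d t fun t' => ih z' t' k) l

/-- The bound on the digits makes extraction exact: peeling the packed integer returns precisely `d
0, d 1, …`, so one long integer serves as a list of coefficients. -/
theorem Adds.digitFold {A : Type*} [AddCommMonoid A] {val : T → A} {b : ℤ}
    {f : ι → ℤ → T → (T → α) → α} {l : List ι} {n : ℕ} (hn : l.length = n) {d : ℕ → ℤ}
    {w : ℕ → A} (hd : ∀ k < n, 2 * |d k| + 1 ≤ b)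
    (h : ∀ k (hk : k < l.length), Adds val (f l[k] (d k)) (w k)) :
    Adds val (digitFold b f l (∑ k ∈ Finset.range n, d k * b ^ k))
      (∑ k ∈ Finset.range n, w k) := by
  subst hn
  induction l generalizing d w with
  | nil => exact fun t k => ⟨t, rfl, by simp⟩
  | cons x l ih =>
    intro t k
    have h0 : 2 * |d 0| + 1 ≤ b := hd 0 (by simp)
    obtain ⟨t₁, h₁, e₁⟩ := h 0 (by simp) t fun t' => FoxLaplacian.digitFold b f l
      (∑ j ∈ Finset.range l.length, d (j + 1) * b ^ j) t' k
    obtain ⟨t₂, h₂, e₂⟩ := ih (d := fun j => d (j + 1)) (w := fun j => w (j + 1))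
      (h := fun j hj => h (j + 1) (by simpa using hj))
      (hd := fun j hj => hd (j + 1) (by simpa using hj)) t₁ k
    refine ⟨t₂, ?_, ?_⟩
    · refine Eq.trans ?_ (h₁.trans h₂)
      change forceInt (digit b _) (fun d => forceInt (shift b _) fun z' =>
        f x d t fun t' => FoxLaplacian.digitFold b f l z' t' k) = _
      rw [forceInt_eq, forceInt_eq, List.length_cons, sum_pow_succ, digit_add_mul h0,
        shift_add_mul h0]
      rfl
    · rw [e₂, e₁, List.length_cons, Finset.sum_range_succ', add_assoc, add_comm (w 0)]

/-- From a list of pairs `(a, p)` compute the sum of the products `digit b a * p`, and the list of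
the pairs `(shift b a, p)`. -/
def digitDot (b : ℤ) (l : List (ℤ × ℤ)) : (ℤ → List (ℤ × ℤ) → α) → α :=
  List.rec (fun k => k 0 [])
    (fun x _ ih k => Prod.rec (fun a p => forceInt (shift b a) fun a' =>
      ih fun s l' => forceInt (digit b a * p + s) fun s' => k s' ((a', p) :: l')) x) l

theorem digitDot_eq (b : ℤ) (l : List (ℤ × ℤ)) (k : ℤ → List (ℤ × ℤ) → α) :
    digitDot b l k = k (l.map fun x => digit b x.1 * x.2).sum
      (l.map fun x => (shift b x.1, x.2)) := by
  induction l generalizing k with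
  | nil => rfl
  | cons x l ih =>
    change forceInt (shift b x.1) (fun a' => digitDot b l fun s l' =>
      forceInt (digit b x.1 * x.2 + s) fun s' => k s' ((a', x.2) :: l')) = _
    rw [forceInt_eq, ih, forceInt_eq]
    rfl

/-- Run `f` on the items of a list together with the successive values of `digitDot`. -/
def dotFold (b : ℤ) (f : ι → ℤ → T → (T → α) → α) (l : List ι) :
    List (ℤ × ℤ) → T → (T → α) → α :=
  List.rec (fun _ t k => k t)
    (fun x _ ih v t k => digitDot b v fun d v' => f x d t fun t' => ih v' t' k) l

/-- Round `k` peels one digit from each first component and so sees the `k`th digits of all of them.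
The folding thus multiplies a matrix of digits by a vector of long integers, one output at a time.
-/
theorem Adds.dotFold {A : Type*} [AddCommMonoid A] {val : T → A} {b : ℤ}
    {f : ι → ℤ → T → (T → α) → α} {l : List ι} {n : ℕ} (hn : l.length = n)
    {v : List (ℤ × ℤ)} {w : ℕ → A}
    (h : ∀ k (hk : k < l.length),
      Adds val (f l[k] (v.map fun x => digitAt b x.1 k * x.2).sum) (w k)) :
    Adds val (dotFold b f l v) (∑ k ∈ Finset.range n, w k) := by
  subst hn
  induction l generalizing v w with
  | nil => exact fun t k => ⟨t, rfl, by simp⟩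
  | cons x l ih =>
    intro t k
    obtain ⟨t₁, h₁, e₁⟩ := h 0 (by simp) t fun t' => FoxLaplacian.dotFold b f l
      (v.map fun x => (shift b x.1, x.2)) t' k
    obtain ⟨t₂, h₂, e₂⟩ := ih (v := v.map fun x => (shift b x.1, x.2)) (w := fun j => w (j + 1))
      (fun j hj => by
        have := h (j + 1) (by simpa using hj)
        rw [List.map_map]
        exact this) t₁ k
    refine ⟨t₂, ?_, ?_⟩
    · refine Eq.trans ?_ (h₁.trans h₂)
      change digitDot b v (fun d v' => f x d t fun t' => FoxLaplacian.dotFold b f l v' t' k) = _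
      rw [digitDot_eq]
      rfl
    · rw [e₂, e₁, List.length_cons, Finset.sum_range_succ', add_assoc, add_comm (w 0)]

end Evaluation

/-! ### Weighted keys -/

/-- Binary search trees with integer weights on natural keys. -/
inductive WeightTree : Type
  | leaf : WeightTree
  | node : WeightTree → ℕ → ℤ → WeightTree → WeightTree

namespace WeightTree

/-- Add the weight `c` at `key` and pass the resulting tree on. -/
def insert {α : Type} (key : ℕ) (c : ℤ) (t : WeightTree) : (WeightTree → α) → α :=
  WeightTree.rec (fun k => k (.node .leaf key c .leaf))
    (fun l n d r ihl ihr k =>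
      Bool.rec
        (Bool.rec (ihr fun r' => k (.node l n d r')) (ihl fun l' => k (.node l' n d r))
          (Nat.ble key n))
        (forceInt (d + c) fun e => k (.node l n e r))
        (Nat.beq key n)) t

/-- The sum of the absolute values of the weights. -/
def total (t : WeightTree) : ℕ :=
  WeightTree.rec 0 (fun _ _ c _ a b => a + c.natAbs + b) t

/-- The sum of the values of `f` at the keys, with the given weights. -/
def value {A : Type*} [AddCommGroup A] (f : ℕ → A) : WeightTree → A
  | leaf => 0
  | node l n c r => value f l + c • f n + value f r

theorem insert_node {α : Type} (key : ℕ) (c : ℤ) (l : WeightTree) (n : ℕ) (d : ℤ) (r : WeightTree)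
    (k : WeightTree → α) :
    insert key c (.node l n d r) k =
      bif Nat.beq key n then forceInt (d + c) fun e => k (.node l n e r)
      else bif Nat.ble key n then insert key c l fun l' => k (.node l' n d r)
      else insert key c r fun r' => k (.node l n d r') := by
  cases h : Nat.beq key n <;> cases h' : Nat.ble key n <;> simp only [insert, h, h', cond]

/-- This holds for every tree, ordered or not: insertion changes one weight or creates one node. The
search order serves only to merge equal keys quickly; unmerged keys could merely increase `total`.
-/
theorem adds_insert {α : Type} {A : Type*} [AddCommGroup A] (f : ℕ → A) (key : ℕ) (c : ℤ) :
    Adds (α := α) (value f) (insert key c) (c • f key) := by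
  intro t
  induction t with
  | leaf => exact fun k => ⟨.node .leaf key c .leaf, rfl, by simp [value]⟩
  | node l n d r ihl ihr =>
    intro k
    rw [insert_node]
    cases hb : Nat.beq key n with
    | true =>
      refine ⟨.node l n (d + c) r, forceInt_eq _ fun e => k (.node l n e r), ?_⟩
      rw [Nat.eq_of_beq_eq_true hb]
      simp only [value, add_smul]
      abel
    | false =>
      cases Nat.ble key n with
      | true =>
        obtain ⟨l', h, e⟩ := ihl fun l' => k (.node l' n d r)
        exact ⟨.node l' n d r, h, by simp only [value, e]; abel⟩
      | false =>
        obtain ⟨r', h, e⟩ := ihr fun r' => k (.node l n d r')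
        exact ⟨.node l n d r', h, by simp only [value, e]; abel⟩

end WeightTree

/-! ### Sums of hermitian squares -/

section HermitianSquares

/-- The sums of elements `star s * s`. -/
def hermitianSquares (A : Type*) [Ring A] [StarRing A] : AddSubmonoid A :=
  AddSubmonoid.closure (Set.range fun s : A => star s * s)

theorem star_mul_self_mem_hermitianSquares {A : Type*} [Ring A] [StarRing A] (s : A) :
    star s * s ∈ hermitianSquares A :=
  AddSubmonoid.subset_closure ⟨s, rfl⟩

theorem smul_mem_hermitianSquares {A : Type*} [Ring A] [StarRing A] [Algebra ℝ A] [StarModule ℝ A]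
    {c : ℝ} (hc : 0 ≤ c) {x : A} (hx : x ∈ hermitianSquares A) : c • x ∈ hermitianSquares A := by
  induction hx using AddSubmonoid.closure_induction with
  | mem x hx =>
    obtain ⟨s, rfl⟩ := hx
    -- A nonnegative scalar is absorbed into the square through its square root.
    convert star_mul_self_mem_hermitianSquares (√c • s) using 1
    simp [star_smul, smul_smul, Real.mul_self_sqrt hc]
  | zero => simp
  | add x y _ _ hx hy => rw [smul_add]; exact add_mem hx hy

theorem map_mem_hermitianSquares {A B F : Type*} [Ring A] [StarRing A] [Ring B] [StarRing B]
    [FunLike F A B] [RingHomClass F A B] (f : F) (hf : ∀ x, f (star x) = star (f x)) {x : A}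
    (hx : x ∈ hermitianSquares A) : f x ∈ hermitianSquares B := by
  induction hx using AddSubmonoid.closure_induction with
  | mem x hx =>
    obtain ⟨s, rfl⟩ := hx
    simpa [hf] using star_mul_self_mem_hermitianSquares (f s)
  | zero => simp
  | add x y _ _ hx hy => rw [map_add]; exact add_mem hx hy

variable {G : Type*} [Group G]

instance : StarModule ℝ (MonoidAlgebra ℝ G) where
  star_smul c x := by
    induction x using MonoidAlgebra.induction_linear with
    | zero => simp
    | add x y hx hy => rw [smul_add, star_add, star_add, hx, hy, smul_add]
    | single g r => simp [star_single]

theorem star_of (g : G) :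
    star (MonoidAlgebra.of ℝ G g) = MonoidAlgebra.of ℝ G g⁻¹ := star_single g 1

/-- The element is `|c| (1 + g)* (1 + g)` if `c ≥ 0` and `|c| (1 - g)* (1 - g)` if `c < 0`. -/
theorem two_mul_abs_add_mem_hermitianSquares (c : ℝ) (g : G) :
    (2 * |c|) • (1 : MonoidAlgebra ℝ G) +
      c • (MonoidAlgebra.of ℝ G g + MonoidAlgebra.of ℝ G g⁻¹) ∈
      hermitianSquares (MonoidAlgebra ℝ G) := by
  have h : MonoidAlgebra.of ℝ G g⁻¹ * MonoidAlgebra.of ℝ G g = 1 := by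
    rw [← map_mul, inv_mul_cancel, map_one]
  rcases abs_cases c with ⟨hc, h0⟩ | ⟨hc, h0⟩
  · rw [hc]
    convert smul_mem_hermitianSquares h0
      (star_mul_self_mem_hermitianSquares (1 + MonoidAlgebra.of ℝ G g)) using 1
    rw [star_add, star_one, star_of, add_mul, mul_add, mul_add, h]
    simp only [one_mul, mul_one]
    module
  · rw [hc]
    convert smul_mem_hermitianSquares (neg_nonneg.2 h0.le)
      (star_mul_self_mem_hermitianSquares (1 - MonoidAlgebra.of ℝ G g)) using 1
    rw [star_sub, star_one, star_of, sub_mul, mul_sub, mul_sub, h]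
    simp only [one_mul, mul_one]
    module

theorem WeightTree.total_add_value_mem_hermitianSquares (f : ℕ → G) (t : WeightTree) :
    ((2 * t.total : ℕ) : ℝ) • (1 : MonoidAlgebra ℝ G) +
      (t.value (fun k => MonoidAlgebra.of ℝ G (f k)) +
        star (t.value fun k => MonoidAlgebra.of ℝ G (f k))) ∈
      hermitianSquares (MonoidAlgebra ℝ G) := by
  induction t with
  | leaf => simp [WeightTree.total, WeightTree.value]
  | node l n c r ihl ihr =>
    convert add_mem (add_mem ihl (two_mul_abs_add_mem_hermitianSquares (c : ℝ) (f n))) ihr using 1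
    have hc : |(c : ℝ)| = c.natAbs := by rw [Nat.cast_natAbs, Int.cast_abs]
    have ht : (WeightTree.node l n c r).total = l.total + c.natAbs + r.total := rfl
    have hz (x : MonoidAlgebra ℝ G) : c • x = (c : ℝ) • x := (Int.cast_smul_eq_zsmul ℝ c x).symm
    rw [ht, hc]
    simp only [WeightTree.value, star_add, hz, star_smul, star_trivial, star_of]
    push_cast
    module

/-- An element of the group ring which is close to a sum of hermitian squares. -/
theorem add_smul_one_mem_hermitianSquares (f : ℕ → G) (t : WeightTree) {x : MonoidAlgebra ℝ G}
    (hx : star x = x) (ht : t.value (fun k => MonoidAlgebra.of ℝ G (f k)) = x) {n : ℕ}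
    (hn : t.total ≤ n) : (n : ℝ) • 1 + x ∈ hermitianSquares (MonoidAlgebra ℝ G) := by
  have h1 := t.total_add_value_mem_hermitianSquares f
  rw [ht, hx] at h1
  -- As `x` is self-adjoint, `x + star x = 2 x`, and halving leaves `t.total + x`. The missing `n -
  -- t.total` is a nonnegative multiple of the square `1`.
  have h2 := smul_mem_hermitianSquares (c := 1 / 2) (by norm_num) h1
  have h3 : (1 : MonoidAlgebra ℝ G) ∈ hermitianSquares (MonoidAlgebra ℝ G) := by
    simpa using star_mul_self_mem_hermitianSquares (1 : MonoidAlgebra ℝ G)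
  have h4 := smul_mem_hermitianSquares (c := (n : ℝ) - t.total)
    (sub_nonneg.2 (Nat.cast_le.2 hn)) h3
  convert add_mem h2 h4 using 1
  push_cast
  module

theorem isSumOfHermitianSquares_of_mem {n : Type*} [Fintype n] [DecidableEq n]
    {A : Matrix n n (MonoidAlgebra ℝ G)}
    (hA : A ∈ hermitianSquares (Matrix n n (MonoidAlgebra ℝ G))) : IsSumOfHermitianSquares A := by
  induction hA using AddSubmonoid.closure_induction with
  | mem x hx =>
    obtain ⟨s, rfl⟩ := hx
    exact ⟨1, fun _ => s, by simp [Matrix.star_eq_conjTranspose]⟩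
  | zero => exact ⟨0, fun _ => 0, by simp⟩
  | add x y _ _ hx hy =>
    obtain ⟨k, M, rfl⟩ := hx
    obtain ⟨l, N, rfl⟩ := hy
    exact ⟨k + l, Fin.append M N, by simp [Fin.sum_univ_add]⟩

theorem isSumOfHermitianSquares_of_submatrix {K n : Type*} [Fintype K] [Fintype n] (e : K ≃ n)
    {A : Matrix n n (MonoidAlgebra ℝ G)} (hA : IsSumOfHermitianSquares (A.submatrix e e)) :
    IsSumOfHermitianSquares A := by
  obtain ⟨k, M, h⟩ := hA
  refine ⟨k, fun i => (M i).submatrix e.symm e.symm, ?_⟩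
  have := congrArg (fun B => B.submatrix e.symm e.symm) h
  simp only [Matrix.submatrix_submatrix, Equiv.self_comp_symm, Matrix.submatrix_id_id] at this
  rw [this]
  ext1 i j
  simp [Matrix.sum_apply, Matrix.mul_apply, Matrix.conjTranspose_apply]

end HermitianSquares

/-! ### Equivariant matrices -/

section Crossed

variable {G K : Type*} [Group G] [Group K] [Fintype K] [DecidableEq K] (θ : K →* MulAut G)

/-- The monomial matrices, indexed by `K`, given by the elements of a semidirect product with `K`. -/
def crossedHom : G ⋊[θ] K →* Matrix K K (MonoidAlgebra ℝ G) where
  toFun γ := Matrix.of fun ρ τ =>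
    if τ = ρ * γ.right then MonoidAlgebra.of ℝ G (θ ρ γ.left) else 0
  map_one' := by
    ext1 ρ τ
    simp [Matrix.one_apply, eq_comm, MonoidAlgebra.one_def]
  map_mul' γ γ' := by
    ext1 ρ τ
    rw [Matrix.mul_apply, Finset.sum_eq_single (ρ * γ.right)]
    · simp only [Matrix.of_apply, if_true, SemidirectProduct.mul_left,
        SemidirectProduct.mul_right, map_mul, MulAut.mul_apply, mul_assoc, mul_ite, mul_zero]
    · intro x _ hx
      simp [hx]
    · simp

/-- The homomorphism from the group ring of `G ⋊[θ] K` onto the matrices over the group ring of `G`,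
indexed by `K`, which are equivariant under `K`. -/
def crossedRep : MonoidAlgebra ℝ (G ⋊[θ] K) →ₐ[ℝ] Matrix K K (MonoidAlgebra ℝ G) :=
  MonoidAlgebra.lift ℝ _ _ (crossedHom θ)

theorem crossedRep_of (γ : G ⋊[θ] K) (ρ τ : K) :
    crossedRep θ (MonoidAlgebra.of ℝ _ γ) ρ τ =
      if τ = ρ * γ.right then MonoidAlgebra.of ℝ G (θ ρ γ.left) else 0 := by
  simp only [crossedRep, MonoidAlgebra.lift_of]
  rfl

/-- Compatibility with the involutions is what carries hermitian squares in the group ring of `G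
⋊[θ] K` to hermitian squares of matrices. -/
theorem crossedRep_star (x : MonoidAlgebra ℝ (G ⋊[θ] K)) :
    crossedRep θ (star x) = star (crossedRep θ x) := by
  induction x using MonoidAlgebra.induction_on with
  | of γ =>
    ext1 ρ τ
    rw [star_of, crossedRep_of, Matrix.star_apply, crossedRep_of]
    by_cases h : τ = ρ * γ.right⁻¹
    · subst h
      simp [star_single]
    · rw [if_neg (by simpa using h), if_neg (fun h' => h (by simp [h'])), star_zero]
  | add x y hx hy => simp [hx, hy]
  | smul r x hx =>
    rw [star_smul, map_smul, map_smul, hx]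
    ext1 ρ τ
    simp [Matrix.star_apply]

end Crossed

/-! ### Unitary representations -/

/-- The inequality forces `a` to be self-adjoint, so its spectrum is real, and the order bounds it
below by `c`. Invertibility is the absence of `0` from the spectrum. -/
theorem isUnit_and_spectrum_subset {A : Type*} [CStarAlgebra A] [PartialOrder A] [StarOrderedRing A]
    {c : ℝ} (hc : 0 < c) {a : A} (h : algebraMap ℝ A c ≤ a) :
    IsUnit a ∧ spectrum ℂ a ⊆ (fun t : ℝ => (t : ℂ)) '' Set.Ici c := by
  have hsa : IsSelfAdjoint a := by
    have h' := IsSelfAdjoint.of_nonneg (sub_nonneg.2 h)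
    simpa using h'.add (IsSelfAdjoint.algebraMap A (.all c))
  have hsp := (algebraMap_le_iff_le_spectrum hsa).1 h
  have key : spectrum ℂ a ⊆ (fun t : ℝ => (t : ℂ)) '' Set.Ici c := by
    intro z hz
    have hre := hsa.mem_spectrum_eq_re hz
    refine ⟨z.re, hsp _ ?_, hre.symm⟩
    rw [← spectrum.preimage_algebraMap ℂ, Set.mem_preimage]
    rwa [hre] at hz
  refine ⟨?_, key⟩
  rw [← spectrum.zero_notMem_iff ℂ]
  intro h0
  obtain ⟨t, ht, h⟩ := key h0
  have : t = 0 := Complex.ofReal_eq_zero.1 h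
  exact absurd (this ▸ ht) (not_le.2 hc)

section Spectrum

variable {G H n : Type*} [Group G] [NormedAddCommGroup H] [InnerProductSpace ℂ H]
  [CompleteSpace H] [Fintype n] (π : G →* unitary (H →L[ℂ] H))

theorem repAlgHom_star (x : MonoidAlgebra ℝ G) : repAlgHom π (star x) = star (repAlgHom π x) := by
  induction x using MonoidAlgebra.induction_on with
  | of g =>
    rw [star_of]
    simp only [repAlgHom, MonoidAlgebra.lift_of, MonoidHom.comp_apply, map_inv]
    rfl
  | add x y hx hy => simp [hx, hy]
  | smul r x hx => rw [star_smul, map_smul, map_smul, hx, star_smul]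

theorem repMatrix_apply (A : Matrix n n (MonoidAlgebra ℝ G)) (x : PiLp 2 (fun _ : n => H)) (i : n) :
    repMatrix π A x i = ∑ j, repAlgHom π (A i j) (x j) := by
  simp [repMatrix]

theorem repMatrix_mul (A B : Matrix n n (MonoidAlgebra ℝ G)) :
    repMatrix π (A * B) = repMatrix π A * repMatrix π B := by
  ext x i
  simp only [mul_apply_eq_comp, repMatrix_apply, Matrix.mul_apply, map_sum, map_mul,
    sum_apply]
  exact Finset.sum_comm

theorem repMatrix_add (A B : Matrix n n (MonoidAlgebra ℝ G)) :
    repMatrix π (A + B) = repMatrix π A + repMatrix π B := by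
  ext x i
  simp [repMatrix_apply, Finset.sum_add_distrib]

theorem repMatrix_smul_one [DecidableEq n] (c : ℝ) :
    repMatrix π (c • (1 : Matrix n n (MonoidAlgebra ℝ G))) = algebraMap ℝ _ c := by
  ext x i
  rw [repMatrix_apply, Finset.sum_eq_single i]
  · simp [Algebra.algebraMap_eq_smul_one]
  · intro j _ hj
    simp [Matrix.one_apply_ne' hj]
  · simp

theorem repMatrix_conjTranspose (A : Matrix n n (MonoidAlgebra ℝ G)) :
    repMatrix π Aᴴ = star (repMatrix π A) := by
  rw [ContinuousLinearMap.star_eq_adjoint, ContinuousLinearMap.eq_adjoint_iff]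
  intro x y
  simp only [PiLp.inner_apply, repMatrix_apply, Matrix.conjTranspose_apply, repAlgHom_star,
    sum_inner, inner_sum, ContinuousLinearMap.star_eq_adjoint,
    ContinuousLinearMap.adjoint_inner_left]
  exact Finset.sum_comm

theorem repMatrix_nonneg {A : Matrix n n (MonoidAlgebra ℝ G)} (hA : IsSumOfHermitianSquares A) :
    0 ≤ repMatrix π A := by
  obtain ⟨k, M, rfl⟩ := hA
  let f : Matrix n n (MonoidAlgebra ℝ G) →+ _ := AddMonoidHom.mk' (repMatrix π (n := n)) (repMatrix_add π)
  have : repMatrix π (∑ i, (M i)ᴴ * M i) = ∑ i, repMatrix π ((M i)ᴴ * M i) := map_sum f _ _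
  rw [this]
  refine Finset.sum_nonneg fun i _ => ?_
  rw [repMatrix_mul, repMatrix_conjTranspose]
  exact star_mul_self_nonneg _

theorem repMatrix_spectrum [DecidableEq n] {A : Matrix n n (MonoidAlgebra ℝ G)} {c : ℝ} (hc : 0 < c)
    (hA : IsSumOfHermitianSquares (A - c • (1 : Matrix n n (MonoidAlgebra ℝ G)))) :
    IsUnit (repMatrix π A) ∧
      spectrum ℂ (repMatrix π A) ⊆ (fun t : ℝ => (t : ℂ)) '' Set.Ici c := by
  have hle : algebraMap ℝ _ c ≤ repMatrix π A := by
    have h := repMatrix_nonneg π hA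
    have h' : repMatrix π A = repMatrix π (A - c • (1 : Matrix n n (MonoidAlgebra ℝ G))) +
        algebraMap ℝ _ c := by
      rw [← repMatrix_smul_one π, ← repMatrix_add, sub_add_cancel]
    rw [h']
    exact le_add_of_nonneg_left h
  exact isUnit_and_spectrum_subset hc hle

end Spectrum

/-! ### Fox derivatives in the group ring of the group presented -/

section FoxImage

variable {G S : Type*} [Group G] [DecidableEq S] (gen : S → G)

/-- The image of the Fox derivative `∂w/∂s` in the group ring of `G`. -/
def foxImage (s : S) (w : FreeGroup S) : MonoidAlgebra ℝ G :=
  MonoidAlgebra.mapDomainRingHom ℝ (FreeGroup.lift gen) (foxDeriv s w)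

theorem foxImage_of (s t : S) : foxImage gen s (FreeGroup.of t) = if t = s then 1 else 0 := by
  rw [foxImage, foxDeriv_of]
  split_ifs <;> simp

theorem foxImage_mul (s : S) (u v : FreeGroup S) : foxImage gen s (u * v) =
    foxImage gen s u + MonoidAlgebra.of ℝ G (FreeGroup.lift gen u) * foxImage gen s v := by
  rw [foxImage, foxDeriv_mul, map_add, map_mul]
  congr 2
  simp

theorem foxImage_inv (s : S) (u : FreeGroup S) : foxImage gen s u⁻¹ =
    -(MonoidAlgebra.of ℝ G (FreeGroup.lift gen u)⁻¹ * foxImage gen s u) := by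
  have h := foxImage_mul gen s u⁻¹ u
  rw [inv_mul_cancel, foxImage, foxDeriv_one, map_zero, map_inv] at h
  exact eq_neg_of_add_eq_zero_left h.symm

open scoped commutatorElement in
theorem foxImage_commutator (s : S) (u v : FreeGroup S) : foxImage gen s ⁅u, v⁆ =
    (1 - MonoidAlgebra.of ℝ G (FreeGroup.lift gen (u * v * u⁻¹))) * foxImage gen s u +
      (MonoidAlgebra.of ℝ G (FreeGroup.lift gen u) -
        MonoidAlgebra.of ℝ G (FreeGroup.lift gen ⁅u, v⁆)) * foxImage gen s v := by
  simp only [commutatorElement_def, foxImage_mul, foxImage_inv, map_mul, map_inv, mul_neg,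
    ← mul_assoc]
  noncomm_ring

open scoped commutatorElement in
-- Here `c` is the value of the commutator, so `∂⁅a, b⁆/∂a = 1 - a b a⁻¹ = 1 - c b` and `∂⁅a, b⁆/∂b
-- = a - c`. The hypothesis avoids inverses so that it can be decided on explicit matrices.
theorem foxImage_commutator_of (s a b : S) {c : G} (h : gen a * gen b = c * gen b * gen a) :
    foxImage gen s ⁅FreeGroup.of a, FreeGroup.of b⁆ =
      (1 - MonoidAlgebra.of ℝ G (c * gen b)) * (if a = s then 1 else 0) +
        (MonoidAlgebra.of ℝ G (gen a) - MonoidAlgebra.of ℝ G c) * (if b = s then 1 else 0) := by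
  have h1 := mul_inv_eq_of_eq_mul h
  rw [foxImage_commutator, foxImage_of, foxImage_of]
  simp only [commutatorElement_def, map_mul (FreeGroup.lift gen), map_inv (FreeGroup.lift gen),
    FreeGroup.lift_apply_of, h1, mul_inv_cancel_right]

theorem d₁_apply {R : Type*} (rel : R → FreeGroup S) (r : R) (s : S) :
    d₁ gen rel r s = foxImage gen s (rel r) := rfl

end FoxImage

/-! ### Permutations of the coordinates -/

/-- The action of the symmetric group on `SL₃(ℤ)` by permutations of the coordinates. -/
def permAut : Equiv.Perm (Fin 3) →* MulAut (Matrix.SpecialLinearGroup (Fin 3) ℤ) where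
  toFun σ :=
    { toFun := fun A => ⟨A.1.submatrix σ.symm σ.symm, by
        rw [Matrix.det_submatrix_equiv_self, A.2]⟩
      invFun := fun A => ⟨A.1.submatrix σ σ, by rw [Matrix.det_submatrix_equiv_self, A.2]⟩
      left_inv := fun A => by ext i j; simp
      right_inv := fun A => by ext i j; simp
      map_mul' := fun A B => by
        ext i j
        exact congrFun (congrFun
          (Matrix.submatrix_mul_equiv A.1 B.1 σ.symm σ.symm σ.symm).symm i) j }
  map_one' := by ext; rfl
  map_mul' σ τ := by ext; rfl

theorem permAut_apply (σ : Equiv.Perm (Fin 3)) (A : Matrix.SpecialLinearGroup (Fin 3) ℤ)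
    (i j : Fin 3) : permAut σ A i j = A (σ.symm i) (σ.symm j) := rfl

/-- The semidirect product of `SL₃(ℤ)` and the group of permutations of the coordinates. -/
abbrev PermutedSL : Type := Matrix.SpecialLinearGroup (Fin 3) ℤ ⋊[permAut] Equiv.Perm (Fin 3)

/-- The elements of the semidirect product, with the permutation on the left. -/
def permMul (σ : Equiv.Perm (Fin 3)) (A : Matrix.SpecialLinearGroup (Fin 3) ℤ) : PermutedSL :=
  SemidirectProduct.inr σ * SemidirectProduct.inl A

theorem crossedRep_permMul (σ : Equiv.Perm (Fin 3)) (A : Matrix.SpecialLinearGroup (Fin 3) ℤ)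
    (ρ τ : Equiv.Perm (Fin 3)) :
    crossedRep permAut (MonoidAlgebra.of ℝ _ (permMul σ A)) ρ τ =
      if τ = ρ * σ then MonoidAlgebra.of ℝ _ (permAut τ A) else 0 := by
  rw [crossedRep_of]
  have h : (permMul σ A).right = σ := by simp [permMul]
  rw [h]
  split_ifs with h'
  · rw [h', map_mul, MulAut.mul_apply]
    simp [permMul]
  · rfl

/-- The pair of the first two values of a permutation. -/
def pairOf (σ : Equiv.Perm (Fin 3)) : Pairs := ⟨(σ 0, σ 1), σ.injective.ne (by decide)⟩

/-- The triple of the values of a permutation. -/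
def tripleOf (σ : Equiv.Perm (Fin 3)) : Triples :=
  ⟨(σ 0, σ 1, σ 2), σ.injective.ne (by decide), σ.injective.ne (by decide),
    σ.injective.ne (by decide)⟩

/-- Two values of a permutation of three letters determine the third. Hence `S₃` acts simply
transitively on the generators, and it can replace `Pairs` as index set. -/
theorem pairOf_bijective : Function.Bijective pairOf := by
  rw [Fintype.bijective_iff_injective_and_card]
  exact ⟨by decide, by decide⟩

theorem tripleOf_bijective : Function.Bijective tripleOf := by
  rw [Fintype.bijective_iff_injective_and_card]
  exact ⟨by decide, by decide⟩

/-- Permutations correspond to pairs of distinct indices. -/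
def pairEquiv : Equiv.Perm (Fin 3) ≃ Pairs := Equiv.ofBijective pairOf pairOf_bijective

/-- Permutations correspond to triples of distinct indices. -/
def tripleEquiv : Equiv.Perm (Fin 3) ≃ Triples := Equiv.ofBijective tripleOf tripleOf_bijective

/-- The equivariance behind the whole reduction: permuting coordinates by `ρ` carries `E_{i,j}` to
`E_{ρ(i),ρ(j)}`. -/
theorem elementary_pairOf_mul (ρ σ : Equiv.Perm (Fin 3)) :
    elementary (pairOf (ρ * σ)) = permAut ρ (elementary (pairOf σ)) := by
  ext i j
  rw [permAut_apply]
  simp only [elementary, Matrix.SpecialLinearGroup.transvection_coe, Matrix.add_apply,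
    Matrix.one_apply, Matrix.single_apply, pairOf, Equiv.Perm.mul_apply, Equiv.eq_symm_apply,
    Equiv.apply_symm_apply]

theorem elementary_pairOf (ρ : Equiv.Perm (Fin 3)) :
    elementary (pairOf ρ) = permAut ρ (elementary (pairOf 1)) := by
  rw [← elementary_pairOf_mul, mul_one]

/-! ### Lists of matrices and permutations -/

/-- The entry of a `3 × 3` matrix listed row by row. -/
def entry (l : List ℤ) (i j : ℕ) : ℤ := l.getD (3 * i + j) 0

/-- The matrix listed row by row. -/
def matOf (l : List ℤ) : Matrix (Fin 3) (Fin 3) ℤ := Matrix.of fun i j => entry l i j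

/-- The matrix listed row by row, as an element of `SL₃(ℤ)`. -/
def toSL (l : List ℤ) : Matrix.SpecialLinearGroup (Fin 3) ℤ :=
  if h : (matOf l).det = 1 then ⟨matOf l, h⟩ else 1

theorem toSL_eq {l : List ℤ} {A : Matrix.SpecialLinearGroup (Fin 3) ℤ} (h : matOf l = A.1) :
    toSL l = A := by
  have hd : (matOf l).det = 1 := by rw [h, A.2]
  exact (dif_pos hd).trans (Subtype.ext h)

/-- The permutations of three letters, numbered from `0` to `5`. -/
def permOf (s : ℕ) : Equiv.Perm (Fin 3) :=
  [1, Equiv.swap 0 1, Equiv.swap 1 2, Equiv.swap 0 2, finRotate 3, (finRotate 3)⁻¹].getD s 1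

/-- The element of the group ring with the listed coefficients, permutations and matrices. -/
def listElem (l : List (ℤ × ℕ × List ℤ)) : MonoidAlgebra ℝ PermutedSL :=
  (l.map fun x => x.1 • MonoidAlgebra.of ℝ _ (permMul (permOf x.2.1) (toSL x.2.2))).sum

/-- The Jacobian rows of the relators `⁅E₁₂, E₁₃⁆`, `⁅E₁₃, E₂₃⁆` and `⁅E₁₂, E₂₃⁆ * E₁₃⁻¹`. -/
def relatorRow : Fin 3 → List (ℤ × ℕ × List ℤ) :=
  -- The permutations `0`, `2`, `4` stand for the columns `E₁₂`, `E₁₃`, `E₂₃`. Since the permutation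
  -- `σ` is written to the left of the matrix, the actual Jacobian entry in column `σ` is the listed
  -- matrix transformed by `permAut σ`: in the first row, `E₁₃` listed in column `2` stands for
  -- `E₁₂`.
  ![[(1, 0, [1, 0, 0, 0, 1, 0, 0, 0, 1]), (-1, 0, [1, 0, 1, 0, 1, 0, 0, 0, 1]),
      (1, 2, [1, 0, 1, 0, 1, 0, 0, 0, 1]), (-1, 2, [1, 0, 0, 0, 1, 0, 0, 0, 1])],
    [(1, 2, [1, 0, 0, 0, 1, 0, 0, 0, 1]), (-1, 2, [1, 0, 0, 0, 1, 0, 0, 1, 1]),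
      (1, 4, [1, 0, 0, 0, 1, 0, 0, 1, 1]), (-1, 4, [1, 0, 0, 0, 1, 0, 0, 0, 1])],
    [(1, 0, [1, 0, 0, 0, 1, 0, 0, 0, 1]), (-1, 0, [1, 0, 1, 0, 1, 1, 0, 0, 1]),
      (1, 4, [1, 0, 0, 0, 1, 0, 1, 0, 1]), (-1, 4, [1, 0, 0, 0, 1, 0, 0, 1, 1]),
      (-1, 2, [1, 0, 0, 0, 1, 0, 0, 0, 1])]]

theorem crossedRep_listElem (l : List (ℤ × ℕ × List ℤ)) (ρ τ : Equiv.Perm (Fin 3)) :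
    crossedRep permAut (listElem l) ρ τ = (l.map fun x => if τ = ρ * permOf x.2.1 then
      x.1 • MonoidAlgebra.of ℝ _ (permAut (ρ * permOf x.2.1) (toSL x.2.2)) else 0).sum := by
  induction l with
  | nil => simp [listElem]
  | cons x l ih =>
    have h : listElem (x :: l) = x.1 • MonoidAlgebra.of ℝ _
      (permMul (permOf x.2.1) (toSL x.2.2)) + listElem l := by simp [listElem]
    rw [h, map_add, Matrix.add_apply, ih, map_zsmul, Matrix.smul_apply, crossedRep_permMul,
      List.map_cons, List.sum_cons, smul_ite, smul_zero]
    congr 1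
    split_ifs with h'
    · rw [h']
    · rfl

theorem pairOf_mul_eq_iff (ρ σ τ : Equiv.Perm (Fin 3)) :
    pairOf (ρ * σ) = pairOf τ ↔ τ = ρ * σ :=
  pairOf_bijective.1.eq_iff.trans eq_comm

/-- The relator of the given type at a triple of indices. -/
def relatorIndex (κ : Fin 3) (t : Triples) : Triples ⊕ Triples ⊕ Triples ⊕ Unit :=
  ![.inl t, .inr (.inl t), .inr (.inr (.inl t))] κ

theorem permAut_mul_toSL {σ σ' : Equiv.Perm (Fin 3)} {l : List ℤ}
    (h : toSL l = permAut σ⁻¹ (elementary (pairOf σ'))) (ρ : Equiv.Perm (Fin 3)) :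
    permAut (ρ * σ) (toSL l) = elementary (pairOf (ρ * σ')) := by
  rw [h, elementary_pairOf_mul, map_mul, MulAut.mul_apply, map_inv, MulAut.apply_inv_self]

open scoped commutatorElement in
-- Each commutator family is a single `S₃`-orbit, so its block of the Jacobian is determined by the
-- row at the triple `(1, 2, 3)`. The relations among elementary matrices are decided at that triple
-- and transported by `permAut ρ`.
theorem d₁_relatorIndex (κ : Fin 3) (ρ τ : Equiv.Perm (Fin 3)) :
    d₁ elementary steinbergRelator (relatorIndex κ (tripleOf ρ)) (pairOf τ) =
      crossedRep permAut (listElem (relatorRow κ)) ρ τ := by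
  have hI : toSL [1, 0, 0, 0, 1, 0, 0, 0, 1] = 1 := toSL_eq (by decide)
  have hcom (i j k : ℕ) (h : elementary (pairOf (permOf i)) * elementary (pairOf (permOf j)) =
      elementary (pairOf (permOf k)) * elementary (pairOf (permOf j)) *
        elementary (pairOf (permOf i))) :
      elementary (pairOf (ρ * permOf i)) * elementary (pairOf (ρ * permOf j)) =
        elementary (pairOf (ρ * permOf k)) * elementary (pairOf (ρ * permOf j)) *
          elementary (pairOf (ρ * permOf i)) := by
    simpa only [map_mul, ← elementary_pairOf_mul] using congrArg (permAut ρ) h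
  have hcom' (i j : ℕ) (h : elementary (pairOf (permOf i)) * elementary (pairOf (permOf j)) =
      elementary (pairOf (permOf j)) * elementary (pairOf (permOf i))) :
      elementary (pairOf (ρ * permOf i)) * elementary (pairOf (ρ * permOf j)) =
        1 * elementary (pairOf (ρ * permOf j)) * elementary (pairOf (ρ * permOf i)) := by
    simpa only [map_mul, ← elementary_pairOf_mul, one_mul] using congrArg (permAut ρ) h
  rw [d₁_apply, crossedRep_listElem]
  fin_cases κ
  · have h0 := permAut_mul_toSL (σ := permOf 0) (σ' := permOf 2)
      (l := [1, 0, 1, 0, 1, 0, 0, 0, 1]) (toSL_eq (by decide)) ρ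
    have h2 := permAut_mul_toSL (σ := permOf 2) (σ' := permOf 0)
      (l := [1, 0, 1, 0, 1, 0, 0, 0, 1]) (toSL_eq (by decide)) ρ
    change foxImage elementary (pairOf τ)
      ⁅FreeGroup.of (pairOf (ρ * permOf 0)), FreeGroup.of (pairOf (ρ * permOf 2))⁆ = _
    rw [foxImage_commutator_of _ _ _ _ (hcom' 0 2 (by decide))]
    simp only [pairOf_mul_eq_iff, relatorRow, Fin.zero_eta, Matrix.cons_val_zero,
      List.map_cons, List.map_nil, List.sum_cons, List.sum_nil, hI, map_one, h0, h2, one_mul]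
    split_ifs <;> simp only [mul_one, mul_zero] <;> module
  · have h2 := permAut_mul_toSL (σ := permOf 2) (σ' := permOf 4)
      (l := [1, 0, 0, 0, 1, 0, 0, 1, 1]) (toSL_eq (by decide)) ρ
    have h4 := permAut_mul_toSL (σ := permOf 4) (σ' := permOf 2)
      (l := [1, 0, 0, 0, 1, 0, 0, 1, 1]) (toSL_eq (by decide)) ρ
    change foxImage elementary (pairOf τ)
      ⁅FreeGroup.of (pairOf (ρ * permOf 2)), FreeGroup.of (pairOf (ρ * permOf 4))⁆ = _
    rw [foxImage_commutator_of _ _ _ _ (hcom' 2 4 (by decide))]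
    simp only [pairOf_mul_eq_iff, relatorRow, Fin.mk_one, Matrix.cons_val_zero, Matrix.cons_val_one,
      List.map_cons, List.map_nil, List.sum_cons, List.sum_nil, hI, map_one, h2, h4, one_mul]
    split_ifs <;> simp only [mul_one, mul_zero] <;> module
  · have h0 : permAut (ρ * permOf 0) (toSL [1, 0, 1, 0, 1, 1, 0, 0, 1]) =
        elementary (pairOf (ρ * permOf 2)) * elementary (pairOf (ρ * permOf 4)) := by
      have h : toSL [1, 0, 1, 0, 1, 1, 0, 0, 1] =
        elementary (pairOf (permOf 2)) * elementary (pairOf (permOf 4)) := toSL_eq (by decide)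
      rw [h, elementary_pairOf_mul, elementary_pairOf_mul, ← map_mul]
      rfl
    have h4 := permAut_mul_toSL (σ := permOf 4) (σ' := permOf 0)
      (l := [1, 0, 0, 0, 1, 0, 1, 0, 1]) (toSL_eq (by decide)) ρ
    have h4' := permAut_mul_toSL (σ := permOf 4) (σ' := permOf 2)
      (l := [1, 0, 0, 0, 1, 0, 0, 1, 1]) (toSL_eq (by decide)) ρ
    have hc := hcom 0 4 2 (by decide)
    change foxImage elementary (pairOf τ)
      (⁅FreeGroup.of (pairOf (ρ * permOf 0)), FreeGroup.of (pairOf (ρ * permOf 4))⁆ *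
        (FreeGroup.of (pairOf (ρ * permOf 2)))⁻¹) = _
    -- The commutator has value `E₁₃` (transported by `ρ`), so the factor `E₁₃⁻¹` contributes `-E₁₃
    -- E₁₃⁻¹ = -1` in its own column.
    have hc' : FreeGroup.lift elementary
        ⁅FreeGroup.of (pairOf (ρ * permOf 0)), FreeGroup.of (pairOf (ρ * permOf 4))⁆ =
        elementary (pairOf (ρ * permOf 2)) := by
      rw [map_commutatorElement, FreeGroup.lift_apply_of, FreeGroup.lift_apply_of,
        commutatorElement_def, mul_inv_eq_of_eq_mul hc, mul_inv_cancel_right]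
    rw [foxImage_mul, foxImage_inv, foxImage_of, hc', FreeGroup.lift_apply_of, mul_neg,
      ← mul_assoc, ← map_mul, mul_inv_cancel, foxImage_commutator_of _ _ _ _ hc]
    simp only [pairOf_mul_eq_iff, relatorRow, Fin.reduceFinMk, Matrix.cons_val,
      List.map_cons, List.map_nil, List.sum_cons, List.sum_nil, hI, map_one, h0, h4, h4', one_mul]
    split_ifs <;> simp only [mul_one, mul_zero] <;> module

/-! ### The Laplacian as the image of one group ring element plus a square. -/

/-- The row of `d₀`. -/
def generatorRow : List (ℤ × ℕ × List ℤ) :=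
  [(1, 0, [1, 0, 0, 0, 1, 0, 0, 0, 1]), (-1, 0, [1, -1, 0, 0, 1, 0, 0, 0, 1])]

/-- The sum of the permutations in the group ring. -/
def permSum : MonoidAlgebra ℝ PermutedSL :=
  ∑ σ : Equiv.Perm (Fin 3), MonoidAlgebra.of ℝ _ (permMul σ 1)

/-- The part of the Laplacian that comes from `d₀` and the commutator relators, as an element of the
group ring of the semidirect product. -/
def reducedLaplacian : MonoidAlgebra ℝ PermutedSL :=
  star (listElem generatorRow) * permSum * listElem generatorRow +
    ∑ κ, star (listElem (relatorRow κ)) * listElem (relatorRow κ)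

/-- The all-ones matrix `J` expresses the rank-one shape of `d₀ d₀*` equivariantly: it equals `D* J
D`, where `D` is the diagonal matrix with entries `star (1 - s)`, the image of `generatorRow`. -/
theorem crossedRep_permSum (ρ τ : Equiv.Perm (Fin 3)) : crossedRep permAut permSum ρ τ = 1 := by
  simp only [permSum, map_sum, Matrix.sum_apply, crossedRep_permMul, map_one]
  rw [Finset.sum_eq_single (ρ⁻¹ * τ)]
  · simp
  · rintro σ - hσ
    exact if_neg fun h => hσ (by rw [h, inv_mul_cancel_left])
  · simp

theorem crossedRep_generatorRow (ρ τ : Equiv.Perm (Fin 3)) :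
    crossedRep permAut (listElem generatorRow) ρ τ =
      if τ = ρ then star (d₀ elementary (pairOf ρ) ()) else 0 := by
  have hI : toSL [1, 0, 0, 0, 1, 0, 0, 0, 1] = 1 := toSL_eq (by decide)
  have hE : toSL [1, -1, 0, 0, 1, 0, 0, 0, 1] = (elementary (pairOf 1))⁻¹ := toSL_eq (by decide)
  have hp : permOf 0 = 1 := rfl
  rw [crossedRep_listElem]
  simp only [generatorRow, List.map_cons, List.map_nil, List.sum_cons, List.sum_nil, hI, hE, hp,
    map_one, map_inv, mul_one, ← elementary_pairOf, d₀, Matrix.of_apply, star_sub, star_one,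
    star_of]
  split_ifs <;> module

/-- The last relator distinguishes the pair `(1, 2)`, so its part of `d₁* d₁` is not equivariant. It
is a row times its adjoint, however, and needs no symmetry to be a hermitian square. -/
theorem laplacian_submatrix :
    ∃ M : Matrix (Equiv.Perm (Fin 3)) (Equiv.Perm (Fin 3)) (MonoidAlgebra ℝ _),
    steinbergLaplacian.submatrix pairEquiv pairEquiv =
      crossedRep permAut reducedLaplacian + star M * M := by
  refine ⟨Matrix.of fun ρ τ =>
    -- The Jacobian row of the last relator is made into a square matrix by padding with zero rows;
    -- putting it at `ρ = 1` is an arbitrary choice.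
    if ρ = 1 then d₁ elementary steinbergRelator (.inr (.inr (.inr ()))) (pairOf τ) else 0, ?_⟩
  have hd₁ (κ : Fin 3) (σ τ : Equiv.Perm (Fin 3)) :
      (crossedRep permAut (star (listElem (relatorRow κ)) * listElem (relatorRow κ))) σ τ =
        ∑ t, star (d₁ elementary steinbergRelator (relatorIndex κ t) (pairOf σ)) *
          d₁ elementary steinbergRelator (relatorIndex κ t) (pairOf τ) := by
    rw [map_mul, crossedRep_star, Matrix.mul_apply, ← tripleEquiv.sum_comp]
    refine Finset.sum_congr rfl fun ρ _ => ?_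
    rw [Matrix.star_apply, ← d₁_relatorIndex, ← d₁_relatorIndex]
    rfl
  ext1 σ τ
  rw [reducedLaplacian, map_add, map_sum, Matrix.add_apply, Matrix.add_apply, Matrix.sum_apply]
  simp only [hd₁, Fin.sum_univ_three]
  have h0 : crossedRep permAut (star (listElem generatorRow) * permSum * listElem generatorRow)
      σ τ = d₀ elementary (pairOf σ) () * star (d₀ elementary (pairOf τ) ()) := by
    simp only [map_mul, crossedRep_star, Matrix.mul_apply, Matrix.star_apply,
      crossedRep_generatorRow, crossedRep_permSum, apply_ite star, star_zero, star_star, mul_one]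
    simp
  have h1 : (star (Matrix.of fun ρ τ : Equiv.Perm (Fin 3) => if ρ = 1 then
        d₁ elementary steinbergRelator (.inr (.inr (.inr ()))) (pairOf τ) else 0) *
      (Matrix.of fun ρ τ : Equiv.Perm (Fin 3) => if ρ = 1 then
        d₁ elementary steinbergRelator (.inr (.inr (.inr ()))) (pairOf τ) else 0)) σ τ =
      star (d₁ elementary steinbergRelator (.inr (.inr (.inr ()))) (pairOf σ)) *
        d₁ elementary steinbergRelator (.inr (.inr (.inr ()))) (pairOf τ) := by
    rw [Matrix.mul_apply, Finset.sum_eq_single 1]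
    · simp [Matrix.star_apply]
    · intro ρ _ hρ
      simp [hρ]
    · simp
  rw [h0, h1]
  change (d₀ elementary * (d₀ elementary)ᴴ + (d₁ elementary steinbergRelator)ᴴ *
    d₁ elementary steinbergRelator) (pairOf σ) (pairOf τ) = _
  rw [Matrix.add_apply, Matrix.mul_apply, Matrix.mul_apply, Fintype.sum_sum_type,
    Fintype.sum_sum_type, Fintype.sum_sum_type]
  simp only [Finset.univ_unique, Finset.sum_singleton, Matrix.conjTranspose_apply, add_assoc]
  rfl

theorem isSumOfHermitianSquares_steinbergLaplacian_sub {c : ℝ}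
    (h : reducedLaplacian - c • 1 ∈ hermitianSquares (MonoidAlgebra ℝ PermutedSL)) :
    IsSumOfHermitianSquares (steinbergLaplacian - c • (1 : Matrix Pairs Pairs (MonoidAlgebra ℝ
      (Matrix.SpecialLinearGroup (Fin 3) ℤ)))) := by
  apply isSumOfHermitianSquares_of_submatrix pairEquiv
  apply isSumOfHermitianSquares_of_mem
  obtain ⟨M, hM⟩ := laplacian_submatrix
  have h1 : (steinbergLaplacian - c • (1 : Matrix Pairs Pairs (MonoidAlgebra ℝ
      (Matrix.SpecialLinearGroup (Fin 3) ℤ)))).submatrix pairEquiv pairEquiv =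
      steinbergLaplacian.submatrix pairEquiv pairEquiv - c • 1 := by
    ext1 ρ τ
    simp [Matrix.one_apply, pairEquiv.injective.eq_iff]
  have h2 := map_mem_hermitianSquares (crossedRep permAut) (crossedRep_star permAut) h
  rw [map_sub, map_smul, map_one] at h2
  rw [h1, hM, add_sub_right_comm]
  exact add_mem h2 (star_mul_self_mem_hermitianSquares M)

/-! ### The certificate -/

/-- The support of the certificate, each matrix listed row by row. -/
def basisData : List (List ℤ) :=
  [[1, 1, 1, 0, 1, 1, 0, 0, 1], [1, 1, 1, 0, 1, 0, 0, 1, 1], [1, 1, 1, 0, 1, 0, 0, 0, 1],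
   [1, 1, 0, 0, 1, 0, -1, 0, 1], [1, 1, -1, 0, 1, 0, 0, -1, 1], [1, 0, 2, 0, 1, 0, 0, 0, 1],
   [1, 0, 1, 0, 1, 1, 0, 0, 1], [1, 0, 1, 0, 1, 0, 0, 1, 1], [1, 0, 1, 0, 1, 0, 0, -1, 1],
   [1, 0, 1, 0, 1, -1, 0, 0, 1], [1, 0, 0, 1, 1, 0, 0, 0, 1], [1, 0, 0, 0, 1, 0, 1, -1, 1],
   [1, 0, 0, 0, 1, 0, 0, 2, 1], [1, 0, 0, 0, 1, 0, 0, -2, 1], [1, 0, 0, 0, 0, 1, 0, -1, 1],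
   [1, 0, 0, 0, 0, -1, 0, 1, 1], [1, 0, 0, -1, 1, 0, 1, -1, 1], [1, 0, 0, -1, 1, 0, 0, 1, 1],
   [1, 0, -1, 0, 1, 0, 0, 1, 1], [1, 0, -1, 0, 1, 0, 0, -1, 1], [1, 0, -1, -1, 1, 0, 0, 0, 1],
   [1, 0, -2, 0, 1, 0, 0, 0, 1], [1, -1, 1, 0, 1, -1, 0, 0, 1], [1, -1, 0, 1, 0, 0, 0, 0, 1],
   [1, -1, 0, 0, 1, 0, 1, 0, 1], [1, -1, 0, -1, 2, 0, 0, 0, 1], [1, -1, -1, 0, 1, 1, 0, 0, 1],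
   [1, -1, -1, 0, 1, 0, 0, 1, 1], [1, -2, 0, 0, 1, 0, 0, 0, 1], [1, 0, 0, -1, 1, 1, 0, 0, 1],
   [1, -1, 0, 0, 1, 0, -1, 0, 1], [1, 0, -1, 0, 1, -1, 0, 0, 1], [1, -1, 1, 0, 1, 0, 0, -1, 1],
   [1, 0, 0, 0, 1, 0, -1, -1, 1], [1, 0, -1, -1, 1, 1, 0, 0, 1], [1, 0, 0, 0, 1, -1, 0, 0, 1],
   [1, 0, 0, 0, 1, 0, -1, 1, 1], [1, 0, 0, 0, 1, 0, -1, 0, 1], [1, 0, 0, 0, 1, 0, 1, 0, 1],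
   [1, 1, -1, 0, 1, 0, 0, 0, 1], [1, 1, 0, 0, 1, 0, 0, -1, 1], [1, -1, 0, 0, 1, 1, 0, 0, 1],
   [1, 0, 0, 0, 1, 0, 1, 1, 1], [1, 0, 0, 0, 1, 1, 0, 0, 1], [1, 1, 0, 0, 1, 0, 0, 1, 1],
   [1, -1, 0, 0, 1, 0, -1, 1, 1], [1, -1, 0, 0, 1, -1, 0, 0, 1], [1, 0, -1, 0, 1, 1, 0, 0, 1],
   [1, -1, 0, 0, 1, 0, 1, -1, 1], [1, -1, 0, 0, 1, 0, 0, 1, 1], [1, 0, 0, -1, 1, 0, 0, 0, 1],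
   [1, 0, -1, 0, 1, 0, 0, 0, 1], [1, -1, 1, 0, 1, 0, 0, 0, 1], [1, 0, 0, 0, 1, 0, 0, 1, 1],
   [1, -1, 0, 0, 1, 0, 0, -1, 1], [1, 0, 1, 0, 1, 0, 0, 0, 1], [1, 1, 0, 0, 1, 0, 0, 0, 1],
   [1, -1, -1, 0, 1, 0, 0, 0, 1], [1, 0, 0, 0, 1, 0, 0, -1, 1], [1, -1, 0, 0, 1, 0, 0, 0, 1],
   [1, 0, 0, 0, 1, 0, 0, 0, 1]]

/-- The coefficients of the certificate: each row lists, for the six permutations, an integer whose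
balanced digits are the coefficients on the support. -/
def coeffData : List (List ℤ) :=
  [[1530173960380667601184039803507663957585809483830534778893415458625671769245167407510387666616817982554199533396887786026858747478904425573534072220524920758014528875644025213499466209300968220936809987278161247223880597722257107877325033421105467477302149105755523544364386458039180354773060548964508180508618963683795181664207279,
    136246617158843708933483507389313823401252065323214959793218280349907994418704013738225910213227794713657845409095803852433454916185740511899899174440133375615637719592661445980721312183565230943234807957984709112403534306429010625066425192733803559941856354205311434145790607000621860957142693002767150472780233467382532803394574,
    -68615714076983511499454162911979378985891123425057338564996891365200146888618093771631297228610058061253711221554225621079473684242695617997059067349704350378218660925880143591665177319569327834247195606747478789324137241495608923076820193386201490981706275026321326229990328999158252723111986147668579356396763170638045987469983,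
    51206583296370490181880935522705796288474692700080565286592562694719694633682130065568124843657834545803661583820506665474636173948030247696783823759159469758447038519729558357025563039212804509427699849879332307358524467723455289564324273348265772592020385380777021099021038811011914311071660802035748287373521603488856965907411,
    123669383585615955065627067392635984047853752958603193237838506155202130809892487598675593910079553466017631888308159198346847795303122587075798798276908932555698941172910101590297347520285481282956889151249303149179423266001949341028229041174808906953496621925228779015044683639448809689796166377168215806607613410748001379417565,
    3847055428846698962595832218634455762813575854661802661161699805765812392880893650354701976448268604122965626833540977003884313918941540929711789136097043349025736236673688531591048734422013455521462946902285111539287641067622154668220817088039937308714730758058003585360819661866157121258613983864920429516515262668977172382117],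
   [5583159999101196922952133077642039799839989622182523316541304680807207583771402760879745073486520201738022566243069792870860379813386744944011244793657647050991590579250119182240592159555220518972708070747075610549231634940696120645612614842947196928567307197101796947608769221562752695315642847589024703205889907593429649649,
    413056716201057017612150952235165563960789338399061650883607768943666607532395806294243815719759057122923720236390005988384158440388281131080318871609010525745834460703022202851402898670137689289888769124383453604943981571975992299232695286294696216458846813242478152358091818955870393901827039350156909367390787986210684719,
    -286308354503922098520458852486598891102867612514463347593505334476681808154672875815511886006164964399228749889578182599887144847124270433347790655179416901414427952519016723222913485149949769607217936423922079579913231466387527343200574496576525298903195630733261354219128627787598457708499993673594336650370542870289449558,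
    -102832618673702998855699902442894429014808046359883888179732755061076389219872042226613337589683045660805043281696162149920949425153527881735998879853354772027038874676823916164709686171226879694276128338613516622791553610763337292322297220683141552510357728334691435258882216279588849254176386021870410681999432276969520115,
    63743144154524950444846705325028449344636317070415792848721841786486745270257671102764651115110063512642521943428914327954596144507908040453115404420920925132883679346367136095479640697922046894935900388963075714037052575469831787778066483379491240651373214950444771720881876712580236812504621987364771330009679603189153205,
    -119730739277859777123213114386647273146950269070055314846494391706579982330858972527690514051139566669123133041540158569036311450195793742362687085398690324803326693750760058124724423463700730563114803514882505765149854280026827379393749442762140946551848756055529684083001756845113706237029509291358375847247514712500601678],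
   [13958936009080813508716742727419530375183879199686812716343284376924755646115507085510834055934302559661692961272265547861263472536150056418458170630736232362037652989644338607034566607510047999096248660658788780131134125419998478334870167849031778131320757406414775470803738587425646557150832329368956269142791889878923,
    -475777564311263037183557979491718713906745053373204691830894926804984181777486701268925182999513516127837490396690577996083452360135585982316221556466550187518525950665039086218615792066878648121641236534942024661073020219549369264443210372582273393963258218585533031025239183440187726576638065170380937275601604313525,
    -1070314681951192223463271675119248016201804382784549028525555307848226597100697732338408279414801962013597417532151517295297394996354850044188562843539792984258358838445064417583897157548375841541038085458441260526858555060341358391351213135776011480655744194148117644925836508486083005415356616900161048251326075761658,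
    -191338569719684742053520627868501701034898220033497754283663200539802215434999671721053306624496137827263106001462999668077833626820649471734160862948541317107687778359338069720628336119970675301716132869854232925361933631249249702952703649562187253823647777249256678372028421077660810085849799122355291038943129896034,
    1016213731936390648343775702805653798238108409060283410249194479501211659183796691255070752699931625061814628851608086087051488530125905213469080685374464132676670142367031127324301372953939530994630297281517025757175294884585569648052747258009688501030131300865284205613124057555131389952755609813968302175545835651762,
    137233067933178912981038804047481194861819575385795460939162514520272593993981117565426726999380408026103693685888410237385136135963759660543349057394013487808255177243885991843380496617247987817462553439910419876229316109702245535571993352313646140471841875822839275056219488503624813277612723898844055894960718999408],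
   [45128555678794761402404983128192253041546686734477714533171289044271510302883336249351611591016314925089958955607430213570550424401124858270584743827731839202032696053958192422241313428385292751027137925664123191542830266598615904400479754213805494539872920060306559522704275190735346757843607238533118500056599764,
    -2786422811964617965999922742303455002064844159588408750615447713953853625870908777917238455335549807540660756670157392396290055175472427162609328840586136418573249332467009831882799379444035772898706191529089223052415324376193350099618694429516641495654378886977692078068398624853353869631202584365982877574758112,
    -11193160737244599605767992613918548151117540264549087297925099050460969551873453755280972800795013836325497449961470888203734409209202820928896767170479491663141079503744174488010972060860602053229997373150690241571527999973962082034975179222764457334072316196719587713757231716817232565911268283125930302282136366,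
    3606158175534378671056070522005521440401974765481075675050390667154685180372829546188652743600932190370827806049707264822007009627670982051454911457632741567498094084285662508719063546782587457379728224045905998961419754247337417896659766805103087163645345796674727594194080440899904135253408338658090126759690316,
    9195555956998433042624357139910879503765838053429955117800186279715821632851259304820969887626099558275954767286814502532188090140306809857390574857580180873648525615825075325284756543857471114735696864672304572494658044536770336150738945022683159844196620428163589736540026714968603345441798266264506232244010996,
    -5603755867798960343518118142099830109231981375231519532854643786082198861222836052754394611402494892823515791405204247378989442561756852534732816113090841464543990527366717168956259972820289713140116008111474310096215400040625975746913185709392129620850343609901922018958115491808389174280609297533141553584013427],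
   [175405060823028205244812789413360016758533640047247399312188971367278089339626645675556301076261584907779861429380432604740372448935257361222748753333361693636678561815728835799569329964838699158985460109807278003210214879007730594785541912190602783487973944977162202394545410352851280629579620348332685130102,
    1420872764268911655159057380133357034710180690080851465013766517260605057288461896545212790547151344127869947162096315807356190195220820960142559371369076538219159285023451684014206606010856065662842215821856992505309686736413791125057715430443895641192572171980898120371696334424334124802680190800881517374,
    -1676097774709865804681826698677253583124351621784095596132987361799296182553363242492052529459367825073828514080806556425090195073882535907475779162495896870723895633839072818652828181276724521167690507777889663686634309659499028074502384894173072166942282701222240140793194440173481386930276000894893691245,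
    10270036060245601109494018221252869704834218560284924802269861009567077147433826903203608791748021025019723993369237801469129572718585659256913048406392888020145648602538337330639922767903060199833132540074565750623559670449008645545169393418239663901731578488694282500326929731024580947749811848272243852477,
    12149030048113696279914488475054139756439088956386139951809466469192175452297891835451505083382668209902443601989550584886415937722369431962139685211540037005885293134200921233182242668587366024472852090453027357262727500452446006745396080720899745633720986504900397039941016627729202292669721477150222843982,
    202935526585809690576394314711195829129014838300663757750797764553745555480280285992401608083930743545502043292169670422298956740741047831902445499143385177924843925185848887126538237196359810170437351493449323395291297669010160944035950075693221275225873098208318347664858505320417898697915756798098010177],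
   [630567937832668152142670100751874028604074398138583849530055862078775274419357743449833346269423252045013181913380465039567424566705535421807909563282135790773076720472611676799186818577661074085314516428900013904277726874634474962185599153780582088021117113990415137264978883126052233887532694917086328,
    11908004054984091709333737647415665013568069796990721213073000270160148817821915368634488010204302692138623874064426718602431207562791534316758745474389665465740787776606852176375411194244015130874077892237693518637879391388201632841942456294948885579420253909682723631557380573039345234982133950842067,
    -82916264899106671798891638592256621204319504691694913743381982244487482987034942232710823825136212517326462848200661578117055251398828007452066086212327665538939429723154412972384514137796011431002193518641558935170456377771320594340559211241038406100144814440082679320851336995814388107551550213188392,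
    -39030361382258813790217506135502350098647425231611642572906464554193915503411695250954209097305862026926192446124143304959305476528522520565232114611269430281003974725828894586044182051477967433281903758252496908107998392508883888416984876230363103376065863605059026229418314555283693474210842795572765,
    5493507462188209619842686952518383933929236530763849310028086058799346605833433290192122835843578272523733794800609638789866292829304753910359153890791472520015477650668829774169398325603863963922486638425259567208229815509130573294286478843326874827388369935816498632832841470606609428195105575008620,
    -38392172242223840822896734729624832114827555263316664010907115465808209481822103932350902926603888025581775629834721565264710058521132057768874720987648694461890507942961010450595214277549285278875461119641057002955057349084126109078556854620632508266547391679576402995199530134376272085856665624902356],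
   [2343435634154801995301074043531281736326604273536066804683358794135169840102603003245852542825044332985763242703979749768100160416053783289583487138465385755678762762547706144360600100704689135830488738581425223233356067878966584022028122813018280638324526153437435001580365175638896541769001598460,
    31215805509807988723794349803070027723745544774646466772068881792305165811799639126671482328358039287446587453023358213410433444962623852796832083943192153831023001516909511013109225052334971558490414917090613168118779100497346141282596673921677282825390486379162420087938776105555745943475978128,
    -51771656044797648629042568766440267600683352341872661204297312520780221612728513897652916939195272506090400037924053369707594476651437086200180189860069933054022572430149066975517206746992129635908386879899489216698546290389914877697395117682928323548377473255671795388093362767012055126040901189,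
    -195471615941251565009950082338833948556636017379610439825628815001127630131817592181056803770306438600167075507681047820064963351844355111159296473498052807972359743348311836741716160376490494525981731797025222539325055834321927282771416282115883201161280199834917588704945868130208463915405280375,
    -152443383610081550772567357484670252805468480714989994379300461535378263058392821395472971425353232960998297925299816897591856213734381639045286447696544685650797903717916091408989395438898802318157164671313835415227522351566497811327322049842642345902196907463631381019173446829113256220859563822,
    -8701773758116558098475037666005012975643723161271020046775765578829442548474477231986150606457326930107004094950059274546315045661726931221092075618801867102969634719302408031391315763436214059181244921658762463755025497195874794923736451832485257387986754610709586991563440332330540977104878959],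
   [8284122408460428482328953234767738104576818130254781158745957586288547065312246596974780920635518844997417479224317374738224080949801188826370526404645386596852158076095274967957585861026468107229472078046647121554984700552399889483233771555733878528943673828411899552980958070867340306417972,
    185924507007774677355579379453919267504608306630136750810822934953524014624869159570495801048607972437020804847581178561326077521466593263554484755553442486709944990173409556580985893978976954879150360194587665708541422321619007298694312175325293338518347259862035667673479933217588161805119,
    769421543124266348271878117649424068047273909743434669830788213574241280216646815015624945649815366216582028559445546651596009373467245568247491832225702041203506222957384519646605947419553437540785399173467562101879919621228038290016627102388120283907553983799898649947241281048512576880545,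
    -1418860254051852838045270830257686155322642892075715680651141143026294039689062145085959114928208112132265652879615747908518351048683149378067166457095855988792364558172394692880557681376522962246052933849037947667123623127496514368839991407767441995953479595531438189179471799380167560005175,
    -1065891846122224537536020343171035845487380407201041061647756725789568818491216997838712206002491488561825723162421182844085456590727593434378636254748693764437260616103470439952059805907458191901726266029380825775443947286772684532318009152620405929448576035030341924307097941462740367047123,
    1122384867920058938500925255344586514424392839509978077378635080359647949689421947059134495512766365515487079605537180882839555152434314607822015690593196964631619315307316440551258424164349171590034464232290827774678605297640450546272541119356977106581506292668577121022951233339994737473070],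
   [30292721754004890388670885869272353022975602391251282067273378051515608661941859561057347618888868282510728736605139755713627746523556023827578811116043091049170679613520167755629133938784805379881370589016912899312339749096983272654377632243104347063620198716235587877903850872279924657,
    -261969316067271227405224386506388841270658602177122581335722769328043955726231588656542720690987613478685082935845999212564041860423120895337201506484679507513145770170754416483690405790496099121789595376813170558390738500186462792004847891968655213225996160132178614518476446051598755,
    3962668607666532196419081039415659018563356671311515703233660440661203345216750907385720392104282579473350238327758349266035872625730024200711183803691107585398246481831233138920385123876538438527598902223120265256138305668454917450762595376986666808450320996940975756947795331722779628,
    16274389307544740100167201995112695616046740005791218009842171878680824214135807669175322496728820150481418204845279277356183933214427349444141460399288494826995147011282021067520998324962362764330664323668821000660237781181508369394853920599213354206580799367894392852725493191933354,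
    -1870984242550765251873784233576671014238363863825186504901177409736691138846659365007377764951497562932297539522281415891843547434840833815747177962448856206689867847931079913793047449343012102056543275887189955679455940264384931316289294207286228747732358238678893621526495318057156651,
    2075424360970963662639287910030730211071554985132680335049672121485961391169248094419995983215321692282001985414398804263100909745018016434416379690576690523302653531805347767677299919737189749892474020630023098673368678309120768264483100617089775943389109280437192147118202512144857975],
   [112599477383616318646428054732691490003645895554695528817519491133793418468207045740290945168342465470969294566675672281942665740311350407573474320060449489975506739853705086622592212026950061727298265180376630142289672908040252922380361420295205610444158011034157656765588256850610,
    3620660364797974007845623760001348660644832820341849137064396492109792900578645333318239005247628557496437200587721519262275210677265146702108957358386722308408331693825995137155614002647097749362247668334426055795061791735274741169457988660876857934032746136446743867103454951119,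
    7090640199821594982164356736591411118266180404792849065407108287574440898183624836134511855375453880878077034416777721854746116795102869981628991352698695152316708044741208770094528478108189672280956165414334618593103957967347260356689967493416534305455763226302611927013408894703,
    -4879252663263590106161249048305311590516077827588335325568133341632256629439673623242019121996496711604975635567016867385860991091344281640400469316164002437330812230305067290808603187174518951930569517780260230151289150785765109990591185123261003357146286401982846184744424048554,
    -10409934552386215975609187433160148331366438812297385837761754461013832326352463163602679231480863795445237422779784230873845623460239241650328087170514083626228558737063334152863391715324369034942290227932005626846518800131690789006361815853836355299744815648715896346426104348588,
    1560027251137153356897249077981018355547916174692084405400761337847048784907671434933035762368141924568875878869962718952872523380783930169871228062548013347927297415364377416359335856848413508149703641734158462318123407644259864285840291430093676316362148909790056002876655536333],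
   [399289274519204691223774390789634527200020333520410185118708781413759421898975135496655398101809113065281777942306819405057430581698089447349270648443818531576022261419234021390429330621569461252238530889928959221442364394171668147014289038885902381391864535225014401662975939,
    -18925699799244299868186956261245099838748881890745898362752659415630489399235185513423980972735418212291786755223416839914210954557656451510990774074110196474273501930981845585112245966789662016533948164100821477362108224818334661792494624310365654340485199527472005325781438,
    -7353673242325964872755555772607005596559784841059645922248054490502912655202091456050084191449581543816950357149967694229798425120441228247017077738806885974660467514337842933425538617171849784058539583165457086659791870144818116424505575668514568682693504776262066813270052,
    39668576465043661927645480014682380944893189514455986725948219726569675885659551300280381804702495042958126707947973766528867517161222939416284602076433094414886738122153732985471980285871573203116884863704438407806175424768739131087522037481622185569217781202161433126370291,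
    15079681756298148195127134782621948394896292330825348781284517371853124217039191050352856762372893982887976868393735317346081268779946574458866711986551890961292379425139712761555161179229876773023530786362710599163193928009011111986941869088756152336565829168026150244452231,
    -31942775283282618230522431874091493007181530151500846292649590094993772955179422929452524366178677118590607552922342443686257155166109172946842067133617845298579538477535119072317858105512931374487010001760412075531352394707289807139770443097315237307438233920838927536882266],
   [1375132950924003990742850457182234251928454528121995140136998070757040195667039497818141863058379387467552922884797299382479281926144483079149191139177347799813472299593577776979699989488648072951841415249321440337457060348361579380500923224823524179447924790688009160133,
    -26536721850753355019579503913921345429337436859919193300373832943075172766613306370621332658279561870501012240999504081198375218587152202886740910533194051835220037485750521860396620583305661215424267626721398669746981339901091888075845124971659956497753066622081040560,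
    2482687574443151205767645646832041106430985953449801148916941108657614570932681101294123308083767914130354744691024277506258506895421536271467009710018803856445026840541374497163443400079284673904152644375200347481832820595283757231944889976904211011662715533187080815,
    69937795917345856829707220821342113198201445419554070438123024669572157301791571480144825640106679798701696189757348554273105385375655751088814173814210693859628487533884797454671771197874831738129729511073135638676795331472701090556295985678914686340395612864547914306,
    94831650961442024766800272881388788272355759974062791298657237826070166976889404325367351551914895532679524272183087868221370623017841024461292578408220900017882169800474623713168717623748456474694649243705415949660178682582634158227992898347640857029752787414556868292,
    27375744454786974675923883824215940980230387765200965150413349893061419317046897514741633697735916299872673557499797293996284898407315013280398627959416001955296338367209890933687922331176887670492164214303047369385829442646599330049513374590939820757762888262418170771],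
   [4732915472833838520813075889899136631818405298849129832183340737595600051847985971085898486143594661796043684995905110619627558629484122679192869133459671785441996093958303973776592447026947738312549019292144174767289124086472602925596091576739150503718894178140799,
    -346377010389575481216331266689454433569565627156054014593784649797292804544864557003098736775019520391876495120000963428658628823564484043847365133038551567541609316062197206590076433074277423579016145964501029525767378143774864813035823281380923279270665456711780,
    96681861312032614841558433612010801180546663976419181274835889939694337914897947222302108521447370406338219406597617428982192304145795811882858046742419163119695681459757520055430953747447787963850192784072311373307734146188155024449382262637526936040447705878678,
    -11807352781844457491557216436068501593688700168094677652056436274081761983659344152647335821494796928651607647653710339516706701986245836064166281491511982854059625811887744974112335926038994810955102362871499812656366576241724627122082514024566144897488743301182,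
    -52890281978334331160734765072082886920998951087783078106232193615354768905826700537851304380171611905655965970345831510848234362221887949370070733540377869730441797358451186541099631294537182833812414226782562719921317260476381897385431066633729909972258079372338,
    55724641251159108617605906223466571745077966501865114084240133225620670129950549997147501484867655170804527654340997319414756207477172992591770690874001115513980031587614093755135852747488020909874816371682553962105121859031231986069455922194369228208704014519311],
   [15995237620023497591859075855161983447386402908213357180061262717110038596733059281825841774429143902926087907710731218287970626142260916624426524233152559283346956272400112995383747781373910192847893988682939991064071454604969755544634886113093351493023570250,
    -1258913134045274683981778218428923861662237861152167353186947990007856745659408513918605004452542267907180153649034236274477911085659976598539667507417583294563474205692016374271972986862978475294255777420366675890017233333632144621052458169515996403190729145,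
    -413379815499995218612547235325363674454982681098270655852197363700296663366885756622720986377169997639792587587722609135618425122360625284562854104262826314797450297693290114795344545838194493881486506014820833734226928742608309742613863898284570288284762806,
    -301708246643785915501571150087272843942595573057269646831391890618786106393939071639740244447611722188230626091257246231221436418838387573175286096033121284291240585904039016275233176642681978974750331414308861651444046433833254286377325015221992577904935268,
    811287710179662775153462397444554289347430041157565154864467266534123958787290145405023771630490995693183618770464504428452131914865511966793557712265954529667435049416002756044905100637229265069944727881987557465139020455995978769181833407202857529673775618,
    699604351040128426062781500936256333356473928830672911404887299223984485229392015188317541432221469487301229061688612405832300836805361886057337227114095939168303232858644121064926299337989583154211028967218588354051718361476842543176797568954300231948697322],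
   [63649925844772071075693036737719619323914390330692146311916700437231230234557357445739540725931238118283205970050188477126191642849482603959304799857301609099538169280106530697061021909310207422592007112126201515096443042067416046985741514847384872682415,
    4143691062425382899909345190946076627633105305847464026780104494478751364566748268196276143760498148834290612199423398404411964985912107199318584015098350067876880331675801374057043016452310388967149558445794391322847580842647746030720258636767079167315,
    2038716582340623361549627789097739070798703112630483617449492159343055988355933397924240686448741124032004098205203684806811350077327117085735359752119375740708756560134785348505150735191894269041306578508695511519924305774505200221059304575252780024604,
    -3425927180983173738540310418259467823243289952129510043584513735799262013524596679087696664802023123086631886647370503691218071558046330372272906924588517186514692243540534802740780100617528090606625220953149309268110355944954583245859171701260835093202,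
    -8946082541466896637900306601503415661595191670731843206941454540920655701864214418941836670228282176113519160889849765995486096040643930452805674545206647182713097748760686587396873759490628464434969120323581688715974104463344942998212781160815031485334,
    -3481391289027766861186214305760592275094689238710232243775040619431961874696838922807739021486552504462605121579776525700894827723476050957274730695560065860991971406752235290553748924818774034242457261391395651413930190293621986899601995317280308723594],
   [228930885332882778769994807465649060906925803076515782433962506424307730876025954360783467616964039499149216483395421666408028845649394091553794075433455034779331871953929040057524291106558670459068157124931884359170988374520096151258456803181068061,
    16817472210704898631198688652890060805948919354777585877648140269036847970475892262815462048157676873827079945017799424796861876833823866284687077938877852786354904870785444919358679570460729534590635770793494184133135027547101761740950360295996147,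
    -11662332237944537829693086260489193273015405790949233161916114802809731077695557846826044472099295031706563999852605894098980395270540646882335088160001082120567656974723395091640892911444004694737060671719816391648232887560068623359868069513525876,
    -18155838690233312479522345169252035040651030756782249201746022855602818408757388007482374119978335152164196917618337337829634729057304854216839174350377768167063898678693514037490746559587252701047534018929486177916948687944657483521610556468362488,
    -6042819758729448731320700461546358858486395361638280723510357824579966756977975226694070555931999207816971989464550244221691211299783501332171473574629988355498878533552074425986777059915714136262178950211630874094918326474348550977862497392132677,
    450660282442375624263633302353606611553079044045998618143138339655837120689029817504897416284162356404535611478445166134749101823196417699290048137338900643598904721969286352471995485184025446426647384220351207743355178999328319119660022328458502],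
   [793962565459042170508903605004987837552145057438279544516299241105789495852326468131295792914038140114700124705573990220007666166225464356430864134707022162456664542020631121388777663343093564004118473336908267617783423944654840092045945603399,
    -63789024371493681204828893607045055319469826797753199761273828866049848252089673504424419691127853407268070352455601640531885154877736610186736257668950446615782415346908381355759954370795302046240885097057710398454461588419302182009043421432,
    124061811372379720168647323565854856936991646677015233970381944978160462193128197562116999462068968407377038528945206482406447775044682033365037027809872115610897989715256109143012065617635593867566770528588353312472655892055857911128567846618,
    -30943955089660597479202686343662231250532624568830690764124221048164412283163311597067265546701469373320567900046937893063646325279901608309749619164241027945613963670065759632361570900862147588848614023609143153958279629097215673004446188201,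
    -71264700647101244161663089033378436373486816807030331305437270721813277859195614363464433813792716691908379329893252651394557905733551612899676795094751315405968418345741047848824222165689018484934669487423041423582941631366512186416160836033,
    83715063199131337244785435345128179852193609274620429966560849830511767757091963020280124554247640471878563355132851200693143692951434962696062625016289833757049419095887221370229089060509917616698871676755037221811533667018446811652426562573],
   [2952715389280855456199201583830253709380618528364426171551005540780234275166101492246218226386121462609926457006931429688031213656483271204144358531703714230452365167369457026555590356936798986666390645978526380866122337366592905346554404,
    -388602188642745488339978068825413868094460770274408714928100676838833188735262379289119939876492310844495549666598561004887240966755590816946905298345840981574487980642603641053160771851096336343785731820888971321942264533934121791257729,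
    347465779312891056771812378127483125766854420499724500221714259032807034064705000410686142683217147296406718979254036218751500302025186714668066987813103958714902793061458849750313409334810566047879339096038921468189055867242351663252929,
    -154804562728643621567282568553107211642804551377680780996903423314660389648560419016237211524502452857123818764893597143352769367941694301503158353904869171034673997042584747424120294349498655977019078347705985854911591946418469971426267,
    -397047586119205233286750939567479307200832571006533382721822979560401920818993471025872225082257793669974069425245086352673225077619736202135429824111270678174617413237126520789143723181072795504446424900608375515265422560224761502499826,
    105222019842170495426315046686630727269110779425324124478263367642976557017177328581706819546227262675427065445669302560443470868811011816254966459372123119070429969023449546490591041872991214244122177326171145872252400068041501791750980],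
   [10539764281102642837739917139962578202708834954599634550828215501225472905648485325429255968708859267705039184453104165652530983568770089843789433850270086774757091128881606587343435688752022891701520534970493448589467657182677040353,
    2131298945234000715306163030078588334648259586540419735616854838983041914954033653477801742068393751430498121902900958981139042901351427419777238019180750138087006593576332998075076303739615740102669424960395154870508842040321115575,
    200509392366701335087796179893636693558660274289105762952195766877140057603302535589577789471502205008288100136921203434999565198871385642142607374841715521094539728304717725280617831964994378243386151242705717370379063008348078583,
    -767547341366748223774033398330331046617826202791138188166445984241916969875590079744787157417463365753920839746215421429622502704350762657378338439693482548242755275550269828732778035985279877807931719575133749020835982473650764561,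
    -503352268237792435959337661776559442628068242353720454673777789120689915867179450137888876779066256713336221221427823157325183100561338646408347586646032520636826310809452001015344750741502147436434813565446231571417992616542730300,
    464316365568742647740603305999483897401772252311955638669964062875488607011084581524154007770663522223834996686648084235044999164894631073288954405658525650528155747159362976111009391164251678537390018197496569438438869761239281983],
   [37535432518996493533117732044905801425629308704501212252387712254549977322096643675866018510936967495436181389289940227288805373174436730213772447796256073820774635914011152524563014040018171130217671098201510170419614734874697,
    3685574175692201653490111209468306577923284925522212147320786309614513578250409032746408539624418996466320844137313194659250543007990330952491689284031925240917052054902700224835476146682310306879577086928833918365937007592571,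
    1107549400229686895161854247992468665390596483530868809576399260270815553099511463932814218433730863688918703806384269287408908567246805233799355712695201980236624769600244592764552135042981558819668022442808321360746722362454,
    381696423837765955441399334080421487445209251352124161961459932034892210615132898292373425058458945499156987203741770576333783322751442162551721751013166816121081198527514595262962237052147180455266727035281773358420531084303,
    -854503496963924786757182145327483732476888865134306991533135062554952100196434074371710926135011716964759655066053524653782660498295122523643020636726052476568977356446620524481184606921102811861183685315382553273952221792496,
    -128694954758731026090646837736852323019231596429045965085934014389640220195453610079790496275710042108330276380647902214903768692831887755437118586219002856861348272734376785214735993043612074936596186992079877672441750747762],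
   [134449581330724118951225904373578079640121659621754868002014341533023416202143336264717031543203454671065651050901665540935855104672021984414178101660926378697563694916811052206793805873902388390361564140162553016941805189,
    9950296058980132476320464912942844181324253560500516983673349189697474485919346898485255439245745523016029627318335918476715960282979878502531406765970947671875558733399714437655304936079585912058682659409729717136523480,
    -13838789833153589230485779123138630309196106052125482074346713784555989414268640998211698370739358947791366474109713224210447969517857597165790184439206814696155175748883496668747104359164287135941415402818333666678147193,
    -9911722261952910495373586132307040758853210228623680776451754792698905399866376528707369709676440189363389155411018035781911197418580895339670203275435403741239712694889956049925541319446019163935645557099629246466228936,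
    4715885757106576897161823350220440212329841614183883724493359492336122372603749089444365039301189176538805779306034992643840544069946731077488451061504196583020432765031419161364831076884189805078923383848997218793029374,
    783177384118369116899432002526442058862208996171833153133877656234415710766646889145092642932857912008083564492339727967945429861349353177140489045916486035975455339063656360677698072135261750442519887149016259847783017],
   [463355089997964979766584888092283008949453477058602280945265595874877002926025561538417931226740820062825715761508873274812515116497973932553623955246976069450080379991775151643485097595654071876865815782464820601225,
    -24028042029099890555785384665686535685396105598198538662678950266222366360912115480253843485375201228334642478009960998771804328720492177482028439623312220212566130622754590915824280907036718353543876973759888621839,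
    -51885725778742168655685071779058935134321691977097549132549997940356150612135675422677227586242485665866951175677747660856316778045006678263408029032290107860872023561424577780739595541102237844178037231327510003171,
    -16054061987836116869222856662236312576037341618299609482953333704086717602304132561669740501183397866580965617075982895469481061746465547933702610627516624210190430317706740203132791567381236786579743627371141137076,
    33391336122009469895862745378809890183063131610411132587129037167570891962616415757385632786172554681271556775463226951949510435814671596695238060426413880200176104235928555222063215707482227386858627081167859876476,
    -2440728420892442946997193680833516846131822234846419522481707440989068823910201029109727540771817420787789885322883721787172296382383547412076823181796651503521581122305074702421302246322840038601773800563329203011],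
   [1573323263649645518814363764423172543732915451335246545037945154258635993039847628379919470872532995863041647118323714193800881671527244075300750517728022796756709941196774293022547821844540873012076979475711220,
    48799260710811311059164702061547915830204315209421851601594649104606920117450615683843736405935334269952915156741250753748245984424939824194941203092813697474859922705922533609735511176007988744586746783861089,
    -87969124219890006869229062798007233534518968187307862596417125020898109856121292733645788828668825569253293935334435263054592994564239106431795629796557366032757986032053140475101874543596445078263622807584525,
    379645232728687559815433614307560283027408505191805977920223339151959607202313603472237937431252697629816593977988611674557653621593614630932458787136615942766562677167078582772417763437874350313111095646097893,
    366643205123444184171721060680672237876123390306745647793585249495497670753571957482647822141968913938650158881359902873232464099984671468855470795527666452808930906159600302551182439455002081194640022172857306,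
    -100972389401641516728683240328277305428452936526900207430529723039206341525226296081807876994867668189627457840613865805199334364917627541950708096053309822443074231069383604933682722975142021113791494501433182],
   [5976630654433363295920956721796700004285668253960378493594442789174852412838530281616376512646531669959111780819879417690685374865645072290683293655539748209340002714121786234264878765696112135371558748020,
    65830887731858011348980807406610960524647719516782066056417615133816459784942316145670875135041106215730168065213493192700911637742050973608702845087155581189733363511979722048411211052251083066975718526,
    -78689261579075743070826743892126650557587478803458420770657855227229441073001803773186954773354205180812036646347601472860651066137501842514215881085271600753965348821436578369227581237945502205022830629,
    886390220346032696343338863165977464467453448147512740810178614976344628894086008353231714669931859341039293207848284495450616813481490835477086681905150459862836704637503940602955025566467151562364417048,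
    243721056531388613493696602621993537019751462149548267085736176388861281453402828344859957873884317860557508724521127810505219582818475676097266770400300145977976803850938874549195545192398304416751682244,
    -721053494963967303989065252501654101459636998994489142013211238103229924870170952836883452969180071923969658978199317973551035591696058549766469821073732374612324930551130854002579317303857374384445195620],
   [19845215696598967256516671153498957391413775022524955071119350576056507292318630373653855198647771634925930748664923289174053039456858268216017947313432542450991656278516177083284900677734740986170858,
    6752123766895599531723049692061155275311131236170059508506386991949331508080465044294907702506787952268675345437250564333823396439640894906697033236979027993317120865215824976513760320813225278961340,
    805890530203909487305646333137105631905201562051983922411553854259364864910453653054890433207657397643785864133175542749910722358999526909452362838970240900416852714057644006469950568285446576535284,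
    650568886996283028948963743312151552724693458475885051039496128009082618399808466715814448578064449959577365710067764103804367479311234023270565358134062635564433300836614211388438263664164551518356,
    704310739412260893537238263240588932191421550488096707916932229362614316153738043669638021340927534891052102949130073837406187018656198496060416610460711159244310495511035949624621208197951088230459,
    859636824815554621518004711361913413833319847754875613225030209213769758634420790065909671695794324484252000924397747740200358981231008523630706500884122348467339843307642248350479549056356694619222],
   [72798512401437399657747375518893457971872878278194877621018022372327094842675237522489765741544447812322572094537735586632094061207455558793004218919084008472816223238833270629765264622778058356,
    -13892289788985012481936055940302676179164844371603688757998855649477146682555553704617669054198702742285955571479057270418849861509157104418944636246247679768280364948938798752686270603860901335,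
    17135872551296802182057871447143991255078145637313759379981816441227712666022439926917050027398240973758879686321682089634477536237356157992065879207767771678982424499771004813735957987190634873,
    200417383775100371239690497029512980025249980470897240793946337299992501930353454081878697594822993661843385349773151552673388688290799554614382735110050636951387240103560392152983189451702004,
    -7409470485759165919593331996863009500000750630203431975010751532104528303551298342691038465406710830606579799808292534934306081825391563675967938920807333005721052749405782125961561159419300409,
    9525896334668138503762571235015807059870898047585403089900706756720271439957190253658859755189367149345741966512626181134473971678710201005301239815670614562495604284110389704604700295866876630],
   [253348777119628232717522747499490031219430728479621345362080650814110695311457977988463651852549927810856214414330850852347356164088059247096800357212030806222102892242536233187364196843133,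
    50394349159114454216674277320274378692791228028479853154007974032697838401014709998648243811514721780640700222771674857245518220520824558698985697538258412384278307773116893366026291903157,
    29012878023572229202803594963992294773501086350799929784648746301297417268031062577910771064903786734600609950773651175223166882737622361425098087146313926062653252574917926705381460935143,
    17795196414397576120191920423576919983017669521863274343603434252023951272324785951708673624553943000905742788324283461903257027028038167451360804576951331144422371146850334709328781771116,
    -11115673742834728457918148414096888322754061843140531159495744238240233990928128620751698549289124003353750488072513999736688871821682775447825397266272462214539295854638737197128131542805,
    101891549322199829866202065887463524575868371838572589819397769581361548993841101253569824810092212078477465563283871030381222689740201818173797815512159866906737547513010999337119644355],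
   [861738330741116662057475588511771228756102565888904811170639368903251466161295590531026706935811285098792182750052557499818999708117540208618849107538401291390102472058039488669285915,
    167471287539718438157547114367064234281115789160104680287348464094946956083081643703175065745188194346591203576999219848745901957997736336894244646775522531871977293167839257095830943,
    129802657162911909504448656536565630017239840582107714288714163631649117763213557569026366507932020518718790977572989485095917402752823594754997530414301579633434658874100384471448752,
    -37022076303285152432407263322994375860975657738373358183667336451377210101343950717876257944803781408774103579461310353241700217521463061362612551124038541164557027290202183350615747,
    7586303820959089426514476052668449527842645277585895901998264460716517814763009807513313867161058262402581274714537217426443175120202920639537336592086023959730505115215098503757586,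
    174408833816617512770872843012813488094011927967660461522770571993304353341142121079508536306792963078218011988211175148149838111499628940456739251440061346166230835695647563229954375],
   [2659792202652547383503444311946863981969195435085560214657951423122900918988553151905273366710766609262993795767901077107947948078655755224888515623587358057842959314162913903296,
    645783070108340020538100245048875070598565629275199235095876659085642615878701745947338609521912137722656730752006168906142371114173909136008060419514862791136800148693933359345,
    982148470427748566827393645209292913432411981230071944892495750554417746166984203391529847174132773203738071124573477602775275048715212567452264782153508281463729945845648853871,
    616841867486829010224677804874598643128509245507885337391534891531467131931469621906004668762508767360397371091545500173605646084260764663577451196839793092436243517360183705442,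
    137022538775760518179620577916155002938496601441392386186903908303364685911299131834168647397302034897483023125488122636387159011006776895195912119684786791914361555610303203050,
    502328474680356681730236610341731547800967334464383969721351220115902354205266475315919714143420984313051895594077861952043444564706785100740128367998391192277466239805095675127],
   [7682843131757798288193869580542550406357376745263180188460315359252801132888202422349006958462705580344596550125053510091235532599074379510289811786149454559163171527461064,
    -606661216975113875411898164301203538158945800897694746348141214495660010024901279591226739285084822004743676989265891713673896437478645662362509945923397551712020367147981,
    2151163944880170838490384746022572011378563640491188865294749200751133757432856976420610442887537297871098726936937774388894284131811252234128594044237759325119324655978359,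
    46230794962000391804465396705793780355054607246551105590277374051828930367926531800788540070799266302861694716447493425073775983253560485258958453023915223360398453372269,
    278336027312619368592671483362957569001812750705060174354873043715480757279456342507664235137091460364119474095714299444864785282320196911453430304814263888243350977907320,
    2383260636429631535382077270043145222962769590872943092263465987644655291200417936088310155813574341084540838472187848845587144520122133462160003118203170960984674222996763],
   [29034203739061197348209113597476831981584149643967738774068204379238912062994916499273820003851311588116586686062273773520700146565343472614739883408127828424193997546,
    5056795058897219364244393455214704260604902455569476197586126189622754311409809085459899940830951582654601966990547588991740908429806882147358318491387979782437471839,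
    7676986740349477451339046066220023275115442271142650001273142530804106469298180751220880780865998874831644755570503848135661152563910937228489572762359520214586756538,
    4426921906413318269271244523953074146360199712552832264246026457270953795835628917341870497767181861605133194179916455045274007873997522488499906060718266740055212655,
    -935776348247553078298431484184917739064213358827898865233164747364485037662811364511722166691201975127125037509450313254961313160395340322032478858759895440510420124,
    2314214469575517674548728283323686028722730077384406323858506129150156983657073469407700224851619353118380398222004902925192573382899692664844335321165314602364828386],
   [41614410224253537273582952909197254183310435090712600060258174274176739308890628417979191531517140507260549555853328611304097978405953895256785772606756430283394,
    9912769235221259418364614185636359554970407492190630915263558260912688405326842162400950069614997956781488403067784593152023360826167860686498003479623627701075,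
    16956048282447803878445844972485854923655821821369027002488387960358822769464784938060250567182017709860051605376123619277692112475943320007134160206904436195376,
    50428816443016037591703131220430808279249832920343618291067022133413101469876786658742547452809120930749206378281393854019431816441544546487740242972137185083708,
    34571131124652743087163455109491620890118739916556453553080837545577693759086382450519178116171002679627990592562815967122227101470830453768412240824628050918821,
    1098363016458759100244438781757702641458571859854844236481806795210349840152669409603906489498356805911106709929005914869807396798989527380513693291700125957272]]
/-! ### Keys of group elements -/

/-- The inverses of the permutations `permOf s`, listed by their values. -/
def permInvTable : List (List ℕ) :=
  [[0, 1, 2], [1, 0, 2], [0, 2, 1], [2, 1, 0], [2, 0, 1], [1, 2, 0]]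

/-- The multiplication table of the permutations `permOf s`. -/
def permMulTable : List (List ℕ) :=
  [[0, 1, 2, 3, 4, 5], [1, 0, 4, 5, 2, 3], [2, 5, 0, 4, 3, 1],
    [3, 4, 5, 0, 1, 2], [4, 3, 1, 2, 5, 0], [5, 2, 3, 1, 0, 4]]

/-- The values of the inverse of `permOf s`. -/
def permInvVal (s i : ℕ) : ℕ := (permInvTable.getD s []).getD i 0

/-- The number of the product of two numbered permutations. -/
def permMulIdx (r s : ℕ) : ℕ := (permMulTable.getD r []).getD s 0

/-- The number of the inverse of a numbered permutation. -/
def permInvIdx (s : ℕ) : ℕ := [0, 1, 2, 3, 5, 4].getD s 0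

theorem permOf_symm_val : ∀ s < 6, ∀ i : Fin 3, ((permOf s).symm i : ℕ) = permInvVal s i := by
  decide

theorem permOf_permMulIdx : ∀ r < 6, ∀ s < 6, permOf (permMulIdx r s) = permOf r * permOf s := by
  decide

theorem permOf_permInvIdx : ∀ s < 6, permOf (permInvIdx s) = (permOf s)⁻¹ := by decide

theorem sum_permOf {A : Type*} [AddCommMonoid A] (f : Equiv.Perm (Fin 3) → A) :
    ∑ σ, f σ = ∑ s ∈ Finset.range 6, f (permOf s) := by
  have h : (Finset.univ : Finset (Equiv.Perm (Fin 3))) = (Finset.range 6).image permOf := by decide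
  rw [h, Finset.sum_image]
  have h' : ∀ r < 6, ∀ s < 6, permOf r = permOf s → r = s := by decide
  intro r hr s hs
  exact h' r (Finset.mem_range.1 hr) s (Finset.mem_range.1 hs)

theorem sum_permMulIdx {A : Type*} [AddCommMonoid A] (f : ℕ → A) {r : ℕ} (hr : r < 6) :
    ∑ s ∈ Finset.range 6, f (permMulIdx r s) = ∑ s ∈ Finset.range 6, f s := by
  have h : ∀ r < 6, (Finset.range 6).image (permMulIdx r) = Finset.range 6 ∧
    ∀ s < 6, ∀ t < 6, permMulIdx r s = permMulIdx r t → s = t := by decide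
  obtain ⟨h1, h2⟩ := h r hr
  conv_rhs => rw [← h1]
  rw [Finset.sum_image]
  intro s hs t ht
  exact h2 s (Finset.mem_range.1 hs) t (Finset.mem_range.1 ht)

/-- The entries of the adjugate of a matrix listed row by row. -/
def adjEntry (l : List ℤ) (i j : ℕ) : ℤ :=
  entry l ((j + 1) % 3) ((i + 1) % 3) * entry l ((j + 2) % 3) ((i + 2) % 3) -
    entry l ((j + 1) % 3) ((i + 2) % 3) * entry l ((j + 2) % 3) ((i + 1) % 3)

/-- The list describes a matrix of determinant one, with small entries, whose inverse has small
entries. -/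
def IsSmall (l : List ℤ) : Prop :=
  entry l 0 0 * adjEntry l 0 0 + entry l 0 1 * adjEntry l 1 0 + entry l 0 2 * adjEntry l 2 0 = 1 ∧
    ∀ i < 3, ∀ j < 3, |entry l i j| ≤ 3 ∧ |adjEntry l i j| ≤ 3

instance (l : List ℤ) : Decidable (IsSmall l) := inferInstanceAs (Decidable (_ ∧ _))

theorem adjugate_matOf (l : List ℤ) (i j : Fin 3) : (matOf l).adjugate i j = adjEntry l i j := by
  rw [Matrix.adjugate_fin_three]
  fin_cases i <;> fin_cases j <;> simp [matOf, adjEntry] <;> ring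

theorem IsSmall.det {l : List ℤ} (h : IsSmall l) : (matOf l).det = 1 := by
  rw [← h.1, Matrix.det_fin_three]
  simp [matOf, adjEntry]
  ring

theorem IsSmall.coe_toSL {l : List ℤ} (h : IsSmall l) : (toSL l).1 = matOf l :=
  congrArg Subtype.val (dif_pos h.det)

theorem IsSmall.coe_toSL_inv {l : List ℤ} (h : IsSmall l) (i j : Fin 3) :
    ((toSL l)⁻¹).1 i j = adjEntry l i j := by
  rw [Matrix.SpecialLinearGroup.coe_inv, h.coe_toSL, adjugate_matOf]

/-- The element `A⁻¹ * σ * B` of the semidirect product, for listed matrices `A`, `B` and a numbered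
permutation `σ`. -/
def sandwich (l : List ℤ) (s : ℕ) (l' : List ℤ) : PermutedSL :=
  (SemidirectProduct.inl (toSL l))⁻¹ * permMul (permOf s) (toSL l')

/-- With permutations on the left, those of the two factors meet in the middle, and only their
quotient matters. All pairs with the same quotient therefore share one coefficient. -/
theorem permMul_inv_mul_permMul {s t u : ℕ} (h : permOf u = (permOf s)⁻¹ * permOf t)
    (l l' : List ℤ) :
    (permMul (permOf s) (toSL l))⁻¹ * permMul (permOf t) (toSL l') = sandwich l u l' := by
  simp only [permMul, sandwich, h, mul_inv_rev, map_mul, map_inv, mul_assoc]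

/-- The balanced digits of the key of an element of the semidirect product. -/
def keyDigit (γ : PermutedSL) (k : ℕ) : ℤ :=
  if k < 9 then γ.left (Fin.ofNat 3 (k / 3)) (Fin.ofNat 3 k)
  else (γ.right.symm 0 : ℕ) + 3 * (γ.right.symm 1 : ℕ)

/-- The integer in base `64` with the digits `keyDigit γ`. -/
def intKey (γ : PermutedSL) : ℤ := ∑ k ∈ Finset.range 10, keyDigit γ k * 64 ^ k

/-- The elements of the semidirect product on which `intKey` is injective. -/
def smallElements : Set PermutedSL := {γ | ∀ k < 10, 2 * |keyDigit γ k| + 1 ≤ 64}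

theorem eq_of_sum_pow_eq {b : ℤ} {d d' : ℕ → ℤ} {n : ℕ} (h : ∀ k < n, 2 * |d k| + 1 ≤ b)
    (h' : ∀ k < n, 2 * |d' k| + 1 ≤ b)
    (e : ∑ k ∈ Finset.range n, d k * b ^ k = ∑ k ∈ Finset.range n, d' k * b ^ k) :
    ∀ k < n, d k = d' k := by
  induction n generalizing d d' with
  | zero => simp
  | succ n ih =>
    have h0 := h 0 (by omega)
    have h0' := h' 0 (by omega)
    rw [sum_pow_succ, sum_pow_succ] at e
    have e0 := congrArg (digit b) e
    have e1 := congrArg (shift b) e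
    rw [digit_add_mul h0, digit_add_mul h0'] at e0
    rw [shift_add_mul h0, shift_add_mul h0'] at e1
    intro k hk
    cases k with
    | zero => exact e0
    | succ k =>
      exact ih (fun k hk => h (k + 1) (by omega)) (fun k hk => h' (k + 1) (by omega)) e1 k
        (by omega)

/-- Admissible digits are determined by the integer: nine of them are the matrix entries, and the
last gives `σ⁻¹(0)` and `σ⁻¹(1)`, hence `σ`. -/
theorem intKey_injOn : Set.InjOn intKey smallElements := by
  intro γ hγ γ' hγ' e
  have h := eq_of_sum_pow_eq hγ hγ' e
  have hr : ∀ σ τ : Equiv.Perm (Fin 3), (σ.symm 0 : ℕ) + 3 * (σ.symm 1 : ℕ) =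
    (τ.symm 0 : ℕ) + 3 * (τ.symm 1 : ℕ) → σ = τ := by decide
  have h9 : ((γ.right.symm 0 : ℕ) : ℤ) + 3 * (γ.right.symm 1 : ℕ) =
    (γ'.right.symm 0 : ℕ) + 3 * (γ'.right.symm 1 : ℕ) := h 9 (by omega)
  refine SemidirectProduct.ext ?_ (hr _ _ (by exact_mod_cast h9))
  ext i j
  have := h (3 * i + j) (by omega)
  fin_cases i <;> fin_cases j <;> exact this

/-- An injection of the integers into the natural numbers. -/
def zigzag (z : ℤ) : ℕ := Int.rec (fun n => 2 * n) (fun n => 2 * n + 1) z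

theorem zigzag_injective : Function.Injective zigzag := by
  intro a b h
  cases a <;> cases b <;> simp only [zigzag] at h <;> first | omega | (congr 1; omega)

/-- A left inverse of `zigzag ∘ intKey` on the small elements. -/
def ofKey : ℕ → PermutedSL := Function.invFunOn (zigzag ∘ intKey) smallElements

theorem ofKey_zigzag_intKey {γ : PermutedSL} (h : γ ∈ smallElements) :
    ofKey (zigzag (intKey γ)) = γ :=
  (zigzag_injective.comp_injOn intKey_injOn).leftInvOn_invFunOn h

/-- Four integers. -/
structure Quad : Type where
  x : ℤ
  y : ℤ
  z : ℤ
  w : ℤ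

/-- The dot product of quadruples. -/
def Quad.dot (a b : Quad) : ℤ := a.x * b.x + a.y * b.y + a.z * b.z + a.w * b.w

/-- The columns of the inverse of a matrix, packed. -/
def colQuad (l : List ℤ) : Quad where
  -- The weights are `64 ^ 3` and `64 ^ 6`, the places where rows 1 and 2 of the product begin in
  -- its key; the constant in `w` is `64 ^ 9`, the place of the permutation.
  x := adjEntry l 0 0 + 262144 * adjEntry l 1 0 + 68719476736 * adjEntry l 2 0
  y := adjEntry l 0 1 + 262144 * adjEntry l 1 1 + 68719476736 * adjEntry l 2 1
  z := adjEntry l 0 2 + 262144 * adjEntry l 1 2 + 68719476736 * adjEntry l 2 2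
  w := 18014398509481984

/-- A row of a matrix with permuted rows and columns, packed. -/
def packedRow (s : ℕ) (l : List ℤ) (i : ℕ) : ℤ :=
  entry l (permInvVal s i) (permInvVal s 0) + 64 * entry l (permInvVal s i) (permInvVal s 1) +
    4096 * entry l (permInvVal s i) (permInvVal s 2)

/-- The rows of a matrix with permuted rows and columns, packed. -/
def rowQuad (s : ℕ) (l : List ℤ) : Quad where
  x := packedRow s l 0
  y := packedRow s l 1
  z := packedRow s l 2
  w := (permInvVal s 0 : ℕ) + 3 * (permInvVal s 1 : ℕ)

section Sandwich

variable {l l' : List ℤ} {s : ℕ}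

theorem sandwich_right (l : List ℤ) (s : ℕ) (l' : List ℤ) : (sandwich l s l').right = permOf s := by
  simp [sandwich, permMul]

theorem sandwich_left (hl : IsSmall l) (hl' : IsSmall l') (hs : s < 6) (i j : Fin 3) :
    (sandwich l s l').left i j =
      ∑ k : Fin 3, adjEntry l i k * entry l' (permInvVal s k) (permInvVal s j) := by
  have h : (sandwich l s l').left = (toSL l)⁻¹ * permAut (permOf s) (toSL l') := by
    simp [sandwich, permMul]
  rw [h, Matrix.SpecialLinearGroup.coe_mul, Matrix.mul_apply]
  refine Finset.sum_congr rfl fun k _ => ?_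
  rw [hl.coe_toSL_inv]
  change _ * (toSL l').1 _ _ = _
  rw [hl'.coe_toSL, matOf, Matrix.of_apply, permOf_symm_val s hs, permOf_symm_val s hs]

theorem permInvVal_lt : ∀ s < 6, ∀ i < 3, permInvVal s i < 3 := by decide

/-- An entry of the product is a sum of three terms of absolute value at most `3 * 3`, hence at most
`27`, and `2 * 27 + 1 ≤ 64`. -/
theorem sandwich_mem_smallElements (hl : IsSmall l) (hl' : IsSmall l') (hs : s < 6) :
    sandwich l s l' ∈ smallElements := by
  intro k hk
  unfold keyDigit
  split_ifs with h
  · rw [sandwich_left hl hl' hs]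
    have hb : ∀ i : Fin 3, ∀ j : Fin 3, ∀ k ∈ Finset.univ (α := Fin 3),
        |adjEntry l i k * entry l' (permInvVal s k) (permInvVal s j)| ≤ 9 := by
      intro i j k _
      rw [abs_mul]
      calc _ ≤ (3 : ℤ) * 3 := mul_le_mul (hl.2 i i.2 k k.2).2
            (hl'.2 _ (permInvVal_lt s hs k k.2) _ (permInvVal_lt s hs j j.2)).1
            (abs_nonneg _) (by norm_num)
        _ = 9 := by norm_num
    have := (Finset.abs_sum_le_sum_abs _ _).trans (Finset.sum_le_sum (hb (Fin.ofNat 3 (k / 3))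
      (Fin.ofNat 3 k)))
    simp only [Finset.sum_const, Finset.card_univ, Fintype.card_fin] at this
    have := this.trans (by norm_num : (3 • 9 : ℤ) ≤ 27)
    omega
  · have := ((sandwich l s l').right.symm 0).2
    have := ((sandwich l s l').right.symm 1).2
    rw [abs_of_nonneg (by positivity)]
    omega

/-- The key is bilinear in the two matrices: `∑ 64 ^ (3i + j) aᵢₖ bₖⱼ = ∑ₖ (∑ᵢ 64 ^ (3i) aᵢₖ) (∑ⱼ 64
^ j bₖⱼ)`. Three packed columns against three packed rows give the matrix, and a fourth product
places the permutation. -/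
theorem intKey_sandwich (hl : IsSmall l) (hl' : IsSmall l') (hs : s < 6) :
    intKey (sandwich l s l') = (colQuad l).dot (rowQuad s l') := by
  have h (i j : Fin 3) : keyDigit (sandwich l s l') (3 * i + j) =
      ∑ k : Fin 3, adjEntry l i k * entry l' (permInvVal s k) (permInvVal s j) := by
    rw [← sandwich_left hl hl' hs]
    fin_cases i <;> fin_cases j <;> rfl
  have h9 : keyDigit (sandwich l s l') 9 =
      (permInvVal s 0 : ℕ) + 3 * (permInvVal s 1 : ℕ) := by
    have h0 := permOf_symm_val s hs 0
    have h1 := permOf_symm_val s hs 1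
    simp only [keyDigit, sandwich_right, h0, h1]
    rfl
  have h00 := h 0 0
  have h01 := h 0 1
  have h02 := h 0 2
  have h10 := h 1 0
  have h11 := h 1 1
  have h12 := h 1 2
  have h20 := h 2 0
  have h21 := h 2 1
  have h22 := h 2 2
  simp only [Fin.sum_univ_three, Fin.val_zero, Fin.val_one, Fin.val_two, Nat.reduceMul,
    Nat.reduceAdd] at h00 h01 h02 h10 h11 h12 h20 h21 h22
  simp only [intKey, Finset.sum_range_succ, Finset.sum_range_zero, h00, h01, h02, h10, h11, h12,
    h20, h21, h22, h9, Quad.dot, colQuad, rowQuad, packedRow]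
  ring

theorem ofKey_dot (hl : IsSmall l) (hl' : IsSmall l') (hs : s < 6) :
    ofKey (zigzag ((colQuad l).dot (rowQuad s l'))) = sandwich l s l' := by
  rw [← intKey_sandwich hl hl' hs, ofKey_zigzag_intKey (sandwich_mem_smallElements hl hl' hs)]

end Sandwich

/-! ### The sum of hermitian squares of the certificate -/

/-- The matrices of the support. -/
def basisList (h : ℕ) : List ℤ := basisData.getD h []

/-- The coefficients of a row of the certificate. -/
def coeff (z : List ℤ) (s h : ℕ) : ℤ := digitAt 262144 (z.getD s 0) h

/-- The element of the group ring given by a row of the certificate. -/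
def certElem (z : List ℤ) : MonoidAlgebra ℝ PermutedSL :=
  ∑ s ∈ Finset.range 6, ∑ h ∈ Finset.range 61,
    coeff z s h • MonoidAlgebra.of ℝ _ (permMul (permOf s) (toSL (basisList h)))

/-- The coefficients of the hermitian square of `certElem z`. -/
def rowGram (z : List ℤ) (h s h' : ℕ) : ℤ :=
  ∑ r ∈ Finset.range 6, coeff z r h * coeff z (permMulIdx r s) h'

theorem star_zsmul (c : ℤ) (x : MonoidAlgebra ℝ PermutedSL) : star (c • x) = c • star x :=
  map_zsmul (starAddEquiv (R := MonoidAlgebra ℝ PermutedSL)) c x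

theorem star_smul_of_mul_smul_of (c c' : ℤ) (γ γ' : PermutedSL) :
    star (c • MonoidAlgebra.of ℝ _ γ) * (c' • MonoidAlgebra.of ℝ _ γ') =
      (c * c') • MonoidAlgebra.of ℝ _ (γ⁻¹ * γ') := by
  rw [star_zsmul, star_of, smul_mul_smul_comm, ← map_mul]

/-- In the double sum over permutations the second one is written as `r * s`; the quotient `s`
survives in the group element and the sum over `r` goes into `rowGram`. -/
theorem star_certElem_mul_certElem (z : List ℤ) : star (certElem z) * certElem z =
    ∑ h ∈ Finset.range 61, ∑ s ∈ Finset.range 6, ∑ h' ∈ Finset.range 61,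
      rowGram z h s h' • MonoidAlgebra.of ℝ _ (sandwich (basisList h) s (basisList h')) := by
  have h1 : ∀ r ∈ Finset.range 6, ∀ h ∈ Finset.range 61,
      star (coeff z r h • MonoidAlgebra.of ℝ _ (permMul (permOf r) (toSL (basisList h)))) *
        certElem z = ∑ s ∈ Finset.range 6, ∑ h' ∈ Finset.range 61,
          (coeff z r h * coeff z (permMulIdx r s) h') •
            MonoidAlgebra.of ℝ _ (sandwich (basisList h) s (basisList h')) := by
    intro r hr h _
    rw [certElem, ← sum_permMulIdx _ (Finset.mem_range.1 hr), Finset.mul_sum]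
    refine Finset.sum_congr rfl fun s hs => ?_
    rw [Finset.mul_sum]
    refine Finset.sum_congr rfl fun h' _ => ?_
    rw [star_smul_of_mul_smul_of, permMul_inv_mul_permMul (u := s)]
    rw [permOf_permMulIdx r (Finset.mem_range.1 hr) s (Finset.mem_range.1 hs),
      inv_mul_cancel_left]
  have h2 : star (certElem z) = ∑ r ∈ Finset.range 6, ∑ h ∈ Finset.range 61,
      star (coeff z r h • MonoidAlgebra.of ℝ _ (permMul (permOf r) (toSL (basisList h)))) := by
    simp only [certElem, star_sum]
  rw [h2, Finset.sum_mul]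
  simp only [Finset.sum_mul]
  rw [Finset.sum_congr rfl fun r hr => Finset.sum_congr rfl fun h hh => h1 r hr h hh,
    Finset.sum_comm]
  refine Finset.sum_congr rfl fun h _ => ?_
  rw [Finset.sum_comm]
  refine Finset.sum_congr rfl fun s _ => ?_
  rw [Finset.sum_comm]
  refine Finset.sum_congr rfl fun h' _ => ?_
  rw [rowGram, Finset.sum_smul]

theorem abs_coeff_le (z : List ℤ) (s h : ℕ) : |coeff z s h| ≤ 131072 := by
  have := abs_digit_le (b := 262144) (by norm_num) ((shift 262144)^[h] (z.getD s 0))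
  change |digit _ _| ≤ _
  omega

/-- Six products of balanced digits in base `2 ^ 18` give the bound `6 * 2 ^ 17 * 2 ^ 17`. -/
theorem abs_rowGram_le (z : List ℤ) (h s h' : ℕ) : |rowGram z h s h'| ≤ 103079215104 := by
  refine (Finset.abs_sum_le_sum_abs _ _).trans ((Finset.sum_le_sum fun r _ => ?_).trans
    (by simp : ∑ r ∈ Finset.range 6, (17179869184 : ℤ) ≤ 103079215104))
  rw [abs_mul]
  exact (mul_le_mul (abs_coeff_le z r h) (abs_coeff_le z _ h') (abs_nonneg _)
    (by norm_num)).trans (by norm_num)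

/-- The coefficients of the sum of the hermitian squares of the elements `certElem z`. -/
def gram (d : List (List ℤ)) (h s h' : ℕ) : ℤ := (d.map fun z => rowGram z h s h').sum

theorem abs_gram_le (d : List (List ℤ)) (h s h' : ℕ) :
    |gram d h s h'| ≤ d.length * 103079215104 := by
  induction d with
  | nil => simp [gram]
  | cons z d ih =>
    have h1 := abs_add_le (rowGram z h s h') (gram d h s h')
    have h2 := abs_rowGram_le z h s h'
    change |rowGram z h s h' + gram d h s h'| ≤ _
    rw [List.length_cons]
    push_cast
    linarith

theorem sum_star_certElem_mul_certElem (d : List (List ℤ)) :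
    (d.map fun z => star (certElem z) * certElem z).sum =
    ∑ h ∈ Finset.range 61, ∑ s ∈ Finset.range 6, ∑ h' ∈ Finset.range 61,
      gram d h s h' • MonoidAlgebra.of ℝ _ (sandwich (basisList h) s (basisList h')) := by
  induction d with
  | nil => simp [gram]
  | cons z d ih =>
    rw [List.map_cons, List.sum_cons, ih, star_certElem_mul_certElem]
    simp only [← Finset.sum_add_distrib, ← add_smul]
    rfl

/-! ### The terms of the Laplacian -/

/-- The element `c • A⁻¹ * σ * B` of the group ring. -/
def termElem (t : ℤ × List ℤ × ℕ × List ℤ) : MonoidAlgebra ℝ PermutedSL :=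
  t.1 • MonoidAlgebra.of ℝ _ (sandwich t.2.1 t.2.2.1 t.2.2.2)

/-- The terms of the hermitian square of a listed element. -/
def squareTerms (l : List (ℤ × ℕ × List ℤ)) : List (ℤ × List ℤ × ℕ × List ℤ) :=
  l.flatMap fun a => l.map fun b =>
    (a.1 * b.1, a.2.2, permMulIdx (permInvIdx a.2.1) b.2.1, b.2.2)

/-- The terms of the part of the Laplacian that comes from `d₀`. -/
def generatorTerms : List (ℤ × List ℤ × ℕ × List ℤ) :=
  generatorRow.flatMap fun a => generatorRow.flatMap fun b => [0, 1, 2, 3, 4, 5].map fun s =>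
    (a.1 * b.1, a.2.2, s, b.2.2)

theorem sum_map_flatMap {ι κ A : Type*} [AddMonoid A] (l : List ι) (f : ι → List κ) (g : κ → A) :
    ((l.flatMap f).map g).sum = (l.map fun x => ((f x).map g).sum).sum := by
  induction l with
  | nil => rfl
  | cons x l ih => simp [ih]

theorem star_list_sum {ι : Type*} (l : List ι) (f : ι → MonoidAlgebra ℝ PermutedSL) :
    star (l.map f).sum = (l.map fun x => star (f x)).sum := by
  induction l with
  | nil => simp
  | cons x l ih => simp [ih]

theorem sum_squareTerms {l : List (ℤ × ℕ × List ℤ)} (hl : ∀ a ∈ l, a.2.1 < 6) :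
    ((squareTerms l).map termElem).sum = star (listElem l) * listElem l := by
  have hi : ∀ s < 6, permInvIdx s < 6 := by decide
  rw [squareTerms, sum_map_flatMap]
  conv_rhs => rw [listElem, star_list_sum]
  rw [← List.sum_map_mul_right]
  refine congrArg List.sum (List.map_congr_left fun a ha => ?_)
  rw [← List.sum_map_mul_left, List.map_map]
  refine congrArg List.sum (List.map_congr_left fun b hb => ?_)
  rw [star_smul_of_mul_smul_of, permMul_inv_mul_permMul
    (u := permMulIdx (permInvIdx a.2.1) b.2.1)]
  · rfl
  · rw [permOf_permMulIdx _ (hi _ (hl a ha)) _ (hl b hb), permOf_permInvIdx _ (hl a ha)]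

theorem sum_generatorTerms : (generatorTerms.map termElem).sum =
    star (listElem generatorRow) * permSum * listElem generatorRow := by
  have h0 : ∀ a ∈ generatorRow, permOf a.2.1 = 1 := by decide
  have hs (a b : ℤ × ℕ × List ℤ) (ha : permOf a.2.1 = 1) (hb : permOf b.2.1 = 1) :
      (([0, 1, 2, 3, 4, 5].map fun s => (a.1 * b.1, a.2.2, s, b.2.2)).map termElem).sum =
        star (a.1 • MonoidAlgebra.of ℝ _ (permMul (permOf a.2.1) (toSL a.2.2))) * permSum *
          (b.1 • MonoidAlgebra.of ℝ _ (permMul (permOf b.2.1) (toSL b.2.2))) := by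
    have ht (s : ℕ) : termElem (a.1 * b.1, a.2.2, s, b.2.2) =
        star (a.1 • MonoidAlgebra.of ℝ _ (permMul (permOf a.2.1) (toSL a.2.2))) *
          MonoidAlgebra.of ℝ _ (permMul (permOf s) 1) *
          (b.1 • MonoidAlgebra.of ℝ _ (permMul (permOf b.2.1) (toSL b.2.2))) := by
      rw [star_zsmul, star_of, ha, hb, smul_mul_assoc, ← map_mul, smul_mul_smul_comm, ← map_mul]
      simp [termElem, sandwich, permMul, mul_assoc]
    rw [permSum, sum_permOf, Finset.mul_sum, Finset.sum_mul]
    simp only [List.map_cons, List.map_nil, ht, Finset.sum_range_succ, Finset.sum_range_zero,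
      List.sum_cons, List.sum_nil, add_assoc, zero_add, add_zero]
  rw [generatorTerms, sum_map_flatMap]
  conv_rhs => rw [listElem, star_list_sum]
  rw [← List.sum_map_mul_right, ← List.sum_map_mul_right]
  refine congrArg List.sum (List.map_congr_left fun a ha => ?_)
  rw [sum_map_flatMap, ← List.sum_map_mul_left]
  exact congrArg List.sum (List.map_congr_left fun b hb => hs a b (h0 a ha) (h0 b hb))

/-- The terms of the part of the Laplacian that comes from `d₀` and the commutator relators. -/
def laplacianTerms : List (ℤ × List ℤ × ℕ × List ℤ) :=
  generatorTerms ++ squareTerms (relatorRow 0) ++ squareTerms (relatorRow 1) ++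
    squareTerms (relatorRow 2)

theorem sum_laplacianTerms : (laplacianTerms.map termElem).sum = reducedLaplacian := by
  have h : ∀ κ, ∀ a ∈ relatorRow κ, a.2.1 < 6 := by decide
  simp only [laplacianTerms, List.map_append, List.sum_append, sum_generatorTerms,
    sum_squareTerms (h _), reducedLaplacian, Fin.sum_univ_three, add_assoc]

/-! ### The verification of the certificate -/

section Check

variable {α : Type}

/-- Pass on a quadruple after its entries have been evaluated. -/
def forceQuad (q : Quad) (k : Quad → α) : α :=
  forceInt q.x fun x => forceInt q.y fun y => forceInt q.z fun z => forceInt q.w fun w =>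
    k ⟨x, y, z, w⟩

theorem forceQuad_eq (q : Quad) (k : Quad → α) : forceQuad q k = k q := by
  simp only [forceQuad, forceInt_eq]

/-- Add a term of the group ring to a tree. -/
def addTerm (t : ℤ × List ℤ × ℕ × List ℤ) (T : WeightTree) (k : WeightTree → α) : α :=
  forceNat (zigzag ((colQuad t.2.1).dot (rowQuad t.2.2.1 t.2.2.2))) fun key =>
    T.insert key t.1 k

/-- The coefficients of a row of the certificate for a given permutation, packed in base `2 ^ 44`. -/
def packedCoeff (z : List ℤ) (s : ℕ) : ℤ :=
  ∑ h ∈ Finset.range 61, coeff z s h * 17592186044416 ^ h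

/-- Six integers, packed in base `b`. -/
def packSix (b : ℤ) (x : ℕ → ℤ) : ℤ :=
  x 0 + b * (x 1 + b * (x 2 + b * (x 3 + b * (x 4 + b * x 5))))

/-- A row of the certificate, packed in base `b` after multiplication by each permutation. -/
def packedRows (b : ℤ) (z : List ℤ) (k : List (ℤ × ℤ) → α) : α :=
  mapCont (fun s k => rebase 262144 17592186044416 61 (z.getD s 0) k) [0, 1, 2, 3, 4, 5] fun xs =>
    mapCont (fun r k => forceInt (z.getD r 0) fun a =>
      forceInt (packSix b fun s => xs.getD (permMulIdx r s) 0) fun p => k (a, p))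
      [0, 1, 2, 3, 4, 5] k

theorem packedRows_eq (b : ℤ) (z : List ℤ) (k : List (ℤ × ℤ) → α) :
    packedRows b z k = k ([0, 1, 2, 3, 4, 5].map fun r =>
      (z.getD r 0, packSix b fun s =>
        ([0, 1, 2, 3, 4, 5].map (packedCoeff z)).getD (permMulIdx r s) 0)) := by
  rw [packedRows, mapCont_eq (g := packedCoeff z), mapCont_eq]
  · intro r k
    rw [forceInt_eq, forceInt_eq]
  · intro s k
    rw [rebase_eq]
    rfl

/-- Subtract the sum of the hermitian squares of the certificate from a tree, and pass the result
on. The base `b` is the `61`st power of `2 ^ 44`. -/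
def subtractSquares (b : ℤ) (d : List (List ℤ)) (T : WeightTree) (k : WeightTree → α) : α :=
  mapCont (fun l => forceQuad (colQuad l)) basisData fun cs =>
    mapCont (fun s => mapCont (fun l => forceQuad (rowQuad s l)) basisData)
        [0, 1, 2, 3, 4, 5] fun rs =>
      mapCont (packedRows b) d fun vs =>
        -- For each left support matrix `h`, a single integer `y` holds all the Gram coefficients:
        -- its six digits in base `b` belong to the permutations `s`, and their 61 digits in base `2
        -- ^ 44` belong to the right support matrices `h'`.
        dotFold 262144 (fun c y =>
          digitFold b (fun r x =>
            digitFold 17592186044416 (fun q n T k => forceNat (zigzag (c.dot q)) fun key =>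
              T.insert key (-n) k) r x) rs y) cs vs.flatten T k

end Check

theorem isSmall_of_mem_basisData : ∀ l ∈ basisData, IsSmall l := by decide +kernel

theorem length_basisData : basisData.length = 61 := by decide

theorem length_coeffData : coeffData.length = 32 := by decide

theorem getElem_basisData {h : ℕ} (hh : h < basisData.length) : basisData[h] = basisList h :=
  (List.getD_eq_getElem _ _ hh).symm

theorem isSmall_basisList {h : ℕ} (hh : h < 61) : IsSmall (basisList h) := by
  have hh' : h < basisData.length := by rwa [length_basisData]
  rw [← getElem_basisData hh']
  exact isSmall_of_mem_basisData _ (List.getElem_mem hh')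

/-- The values of weighted trees in the group ring. -/
def treeElem : WeightTree → MonoidAlgebra ℝ PermutedSL :=
  WeightTree.value fun k => MonoidAlgebra.of ℝ _ (ofKey k)

theorem adds_addTerm {α : Type} {t : ℤ × List ℤ × ℕ × List ℤ} (h : IsSmall t.2.1)
    (h' : IsSmall t.2.2.2) (hs : t.2.2.1 < 6) :
    Adds (α := α) treeElem (addTerm t) (termElem t) := by
  intro T k
  have e := WeightTree.adds_insert (α := α) (fun k => MonoidAlgebra.of ℝ _ (ofKey k))
    (zigzag ((colQuad t.2.1).dot (rowQuad t.2.2.1 t.2.2.2))) t.1 T k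
  rw [ofKey_dot h h' hs] at e
  rw [addTerm, forceNat_eq]
  exact e

theorem sum_map_six {A : Type*} [AddCommMonoid A] (f : ℕ → A) :
    ([0, 1, 2, 3, 4, 5].map f).sum = ∑ s ∈ Finset.range 6, f s := by
  simp [Finset.sum_range_succ, add_assoc]

/-- Packing is linear, so multiplying each packed, permuted row by one scalar coefficient and adding
the results computes all the sums `gram d h s h'` at once, side by side. -/
theorem sum_packedRows (b : ℤ) (d : List (List ℤ)) (h : ℕ) :
    (((d.map fun z => [0, 1, 2, 3, 4, 5].map fun r => (z.getD r 0, packSix b fun s =>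
        ([0, 1, 2, 3, 4, 5].map (packedCoeff z)).getD (permMulIdx r s) 0)).flatten).map
      fun x => digitAt 262144 x.1 h * x.2).sum =
    ∑ s ∈ Finset.range 6,
      (∑ h' ∈ Finset.range 61, gram d h s h' * 17592186044416 ^ h') * b ^ s := by
  have hx (z : List ℤ) : ∀ s < 6,
      ([0, 1, 2, 3, 4, 5].map (packedCoeff z)).getD s 0 = packedCoeff z s := by
    intro s hs
    interval_cases s <;> rfl
  have hm : ∀ r < 6, ∀ s < 6, permMulIdx r s < 6 := by decide
  have hz (z : List ℤ) : (([0, 1, 2, 3, 4, 5].map fun r => (z.getD r 0, packSix b fun s =>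
      ([0, 1, 2, 3, 4, 5].map (packedCoeff z)).getD (permMulIdx r s) 0)).map
        fun x => digitAt 262144 x.1 h * x.2).sum =
      ∑ s ∈ Finset.range 6,
        (∑ h' ∈ Finset.range 61, rowGram z h s h' * 17592186044416 ^ h') * b ^ s := by
    have h1 : (([0, 1, 2, 3, 4, 5].map fun r => (z.getD r 0, packSix b fun s =>
        ([0, 1, 2, 3, 4, 5].map (packedCoeff z)).getD (permMulIdx r s) 0)).map
          fun x => digitAt 262144 x.1 h * x.2).sum =
        ∑ r ∈ Finset.range 6, coeff z r h *
          ∑ s ∈ Finset.range 6, packedCoeff z (permMulIdx r s) * b ^ s := by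
      rw [List.map_map]
      have h2 (r : ℕ) (hr : r < 6) : ((fun x : ℤ × ℤ => digitAt 262144 x.1 h * x.2) ∘ fun r =>
          (z.getD r 0, packSix b fun s =>
            ([0, 1, 2, 3, 4, 5].map (packedCoeff z)).getD (permMulIdx r s) 0)) r =
          coeff z r h * ∑ s ∈ Finset.range 6, packedCoeff z (permMulIdx r s) * b ^ s := by
        have h3 : packSix b (fun s =>
            ([0, 1, 2, 3, 4, 5].map (packedCoeff z)).getD (permMulIdx r s) 0) =
            ∑ s ∈ Finset.range 6, packedCoeff z (permMulIdx r s) * b ^ s := by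
          simp only [packSix, hx z _ (hm r hr 0 (by norm_num)), hx z _ (hm r hr 1 (by norm_num)),
            hx z _ (hm r hr 2 (by norm_num)), hx z _ (hm r hr 3 (by norm_num)),
            hx z _ (hm r hr 4 (by norm_num)), hx z _ (hm r hr 5 (by norm_num)),
            Finset.sum_range_succ, Finset.sum_range_zero]
          ring
        rw [Function.comp_apply, h3]
        rfl
      rw [sum_map_six]
      exact Finset.sum_congr rfl fun r hr => h2 r (Finset.mem_range.1 hr)
    rw [h1]
    simp only [Finset.mul_sum]
    rw [Finset.sum_comm]
    refine Finset.sum_congr rfl fun s _ => ?_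
    simp only [packedCoeff, rowGram, Finset.sum_mul, Finset.mul_sum]
    rw [Finset.sum_comm]
    exact Finset.sum_congr rfl fun h' _ => Finset.sum_congr rfl fun r _ => by ring
  induction d with
  | nil => simp [gram]
  | cons z d ih =>
    rw [List.map_cons, List.flatten_cons, List.map_append, List.sum_append, hz, ih,
      ← Finset.sum_add_distrib]
    refine Finset.sum_congr rfl fun s _ => ?_
    rw [← add_mul, ← Finset.sum_add_distrib]
    simp only [← add_mul]
    rfl

theorem adds_subtractSquares {α : Type} {d : List (List ℤ)} (hd : d.length ≤ 32) {b : ℤ}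
    (hb : b = 17592186044416 ^ 61) :
    Adds (α := α) treeElem (subtractSquares b d)
      (-(d.map fun z => star (certElem z) * certElem z).sum) := by
  -- The base `2 ^ 44` leaves room for 32 rows: `2 * 32 * 6 * 2 ^ 34 < 2 ^ 43`, so no coefficient
  -- spills into its neighbour.
  have hg (h s h' : ℕ) : 2 * |gram d h s h'| + 1 ≤ 17592186044416 := by
    have := abs_gram_le d h s h'
    have : (d.length : ℤ) ≤ 32 := by exact_mod_cast hd
    linarith
  have hsum : -(d.map fun z => star (certElem z) * certElem z).sum =
      ∑ h ∈ Finset.range 61, ∑ s ∈ Finset.range 6, ∑ h' ∈ Finset.range 61,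
        (-gram d h s h') • MonoidAlgebra.of ℝ _ (sandwich (basisList h) s (basisList h')) := by
    rw [sum_star_certElem_mul_certElem]
    simp only [neg_smul, Finset.sum_neg_distrib]
  have hfun : subtractSquares (α := α) b d =
      dotFold 262144 (fun c y =>
        digitFold b (fun r x =>
          digitFold 17592186044416 (fun q n T k => forceNat (zigzag (c.dot q)) fun key =>
            T.insert key (-n) k) r x)
          ([0, 1, 2, 3, 4, 5].map fun s => basisData.map (rowQuad s)) y)
        (basisData.map colQuad)
        (d.map fun z => [0, 1, 2, 3, 4, 5].map fun r => (z.getD r 0, packSix b fun s =>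
          ([0, 1, 2, 3, 4, 5].map (packedCoeff z)).getD (permMulIdx r s) 0)).flatten := by
    funext T k
    rw [subtractSquares, mapCont_eq fun l => forceQuad_eq (colQuad l),
      mapCont_eq fun s => mapCont_eq (fun l => forceQuad_eq (rowQuad s l)) basisData,
      mapCont_eq (packedRows_eq b)]
  rw [hsum, hfun]
  refine Adds.dotFold (by rw [List.length_map, length_basisData]) fun h hh => ?_
  rw [List.length_map, length_basisData] at hh
  rw [sum_packedRows]
  refine Adds.digitFold (by simp) (fun s _ => hb ▸ abs_sum_pow_le fun h' _ => hg h s h')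
    fun s hs => ?_
  have hs6 : s < 6 := by simpa using hs
  have hlen : ([0, 1, 2, 3, 4, 5].map fun s => basisData.map (rowQuad s))[s].length = 61 := by
    rw [List.getElem_map, List.length_map, length_basisData]
  refine Adds.digitFold hlen (fun h' _ => hg h s h') fun h' hh' => ?_
  have hs' : [0, 1, 2, 3, 4, 5][s] = s := by interval_cases s <;> rfl
  have hh'' : h' < 61 := hlen ▸ hh'
  intro T k
  have e := WeightTree.adds_insert (α := α) (fun k => MonoidAlgebra.of ℝ _ (ofKey k))
    (zigzag ((colQuad (basisList h)).dot (rowQuad s (basisList h')))) (-gram d h s h') T k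
  rw [ofKey_dot (isSmall_basisList hh) (isSmall_basisList hh'') hs6] at e
  simp only [List.getElem_map, hs', getElem_basisData, forceNat_eq]
  exact e

/-- The terms of `n` times the reduced Laplacian minus `c` times the identity. -/
def scaledTerms (n c : ℤ) : List (ℤ × List ℤ × ℕ × List ℤ) :=
  (-c, [1, 0, 0, 0, 1, 0, 0, 0, 1], 0, [1, 0, 0, 0, 1, 0, 0, 0, 1]) ::
    laplacianTerms.map fun t => (n * t.1, t.2)

/-- The certificate is accurate enough. -/
def certificateCheck : Bool :=
  -- The scale is `10 ^ 10`, and the squares are compared with the Laplacian minus `1.32`. The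
  -- permitted `ℓ¹` error `10 ^ 10` costs `1`, which leaves `0.32`.
  foldCont addTerm (scaledTerms 10000000000 13200000000) .leaf fun T =>
    forceInt (17592186044416 ^ 61) fun b =>
      subtractSquares b coeffData T fun T => Nat.ble T.total 10000000000

theorem certificateCheck_eq_true : certificateCheck = true := by decide +kernel

theorem isSmall_scaledTerms (n c : ℤ) :
    ∀ t ∈ scaledTerms n c, IsSmall t.2.1 ∧ IsSmall t.2.2.2 ∧ t.2.2.1 < 6 := by
  have h : IsSmall [1, 0, 0, 0, 1, 0, 0, 0, 1] ∧
      ∀ t ∈ laplacianTerms, IsSmall t.2.1 ∧ IsSmall t.2.2.2 ∧ t.2.2.1 < 6 := by decide +kernel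
  intro t ht
  rcases List.mem_cons.1 ht with rfl | ht
  · exact ⟨h.1, h.1, by norm_num⟩
  · obtain ⟨t', ht', rfl⟩ := List.mem_map.1 ht
    exact h.2 t' ht'

theorem sum_scaledTerms (n c : ℤ) : ((scaledTerms n c).map termElem).sum =
    (n : ℝ) • reducedLaplacian - (c : ℝ) • 1 := by
  have hI : toSL [1, 0, 0, 0, 1, 0, 0, 0, 1] = 1 := toSL_eq (by decide)
  have hp : permOf 0 = 1 := rfl
  have h1 : termElem (-c, [1, 0, 0, 0, 1, 0, 0, 0, 1], 0, [1, 0, 0, 0, 1, 0, 0, 0, 1]) =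
      -((c : ℝ) • 1) := by
    simp only [termElem, sandwich, permMul, hI, hp, map_one, inv_one, mul_one, neg_smul,
      Int.cast_smul_eq_zsmul]
  have h2 (l : List (ℤ × List ℤ × ℕ × List ℤ)) :
      ((l.map fun t => (n * t.1, t.2)).map termElem).sum = (n : ℝ) • (l.map termElem).sum := by
    induction l with
    | nil => simp
    | cons t l ih =>
      simp only [List.map_cons, List.sum_cons, ih, smul_add, termElem, mul_smul,
        Int.cast_smul_eq_zsmul]
  rw [scaledTerms, List.map_cons, List.sum_cons, h1, h2, sum_laplacianTerms]
  abel

/-- Needed because the `ℓ¹` estimate applies only to a self-adjoint remainder. -/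
theorem star_reducedLaplacian : star reducedLaplacian = reducedLaplacian := by
  have h : star permSum = permSum := by
    simp only [permSum, star_sum, star_of]
    rw [← Equiv.sum_comp (Equiv.inv (Equiv.Perm (Fin 3)))]
    refine Finset.sum_congr rfl fun σ _ => ?_
    simp [permMul]
  simp only [reducedLaplacian, star_add, star_sum, star_mul, star_star, h, mul_assoc]

theorem reducedLaplacian_sub_mem_hermitianSquares :
    reducedLaplacian - (0.32 : ℝ) • 1 ∈ hermitianSquares (MonoidAlgebra ℝ PermutedSL) := by
  obtain ⟨T₁, h₁, e₁⟩ := Adds.foldCont (α := Bool) (scaledTerms 10000000000 13200000000)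
    (fun t ht =>
      have h := isSmall_scaledTerms _ _ t ht
      adds_addTerm h.1 h.2.1 h.2.2) .leaf
    fun T => forceInt (17592186044416 ^ 61) fun b =>
      subtractSquares b coeffData T fun T => Nat.ble T.total 10000000000
  obtain ⟨T₂, h₂, e₂⟩ := adds_subtractSquares (α := Bool) (d := coeffData)
    length_coeffData.le (b := 17592186044416 ^ 61) rfl T₁ fun T => Nat.ble T.total 10000000000
  rw [forceInt_eq] at h₁
  -- `T₁` and `T₂` are the trees reached by the computation, so the Boolean evaluated by the kernel
  -- is the comparison at `T₂`.
  have hT : T₂.total ≤ 10000000000 :=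
    Nat.le_of_ble_eq_true ((h₁.trans h₂).symm.trans certificateCheck_eq_true)
  set sq := (coeffData.map fun z => star (certElem z) * certElem z).sum with hsq
  have hv : treeElem T₂ = (10000000000 : ℝ) • reducedLaplacian - (13200000000 : ℝ) • 1 - sq := by
    rw [e₂, e₁, sum_scaledTerms, Int.cast_ofNat, Int.cast_ofNat, ← sub_eq_add_neg, show treeElem .leaf = 0 from rfl, zero_add]
  have hmem : sq ∈ hermitianSquares (MonoidAlgebra ℝ PermutedSL) := by
    refine list_sum_mem fun x hx => ?_
    obtain ⟨z, -, rfl⟩ := List.mem_map.1 hx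
    exact star_mul_self_mem_hermitianSquares _
  have hstar : star sq = sq := by
    rw [hsq, star_list_sum]
    simp only [star_mul, star_star]
  have h := add_smul_one_mem_hermitianSquares ofKey T₂ (by
    rw [star_sub, star_sub, star_smul, star_smul, star_one, star_reducedLaplacian, hstar]
    rfl) hv hT
  -- With `r` the value of `T₂`, `(10¹⁰ + r) + sq = 10¹⁰ reducedLaplacian - (1.32 - 1) 10¹⁰`, and
  -- dividing by `10¹⁰` gives the claim.
  convert smul_mem_hermitianSquares (c := 1 / 10000000000) (by norm_num) (add_mem h hmem) using 1
  push_cast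
  module

end FoxLaplacian

end

theorem theorem1 :
    ∃ lam : ℝ, 0 < lam ∧ 0.32 ≤ lam ∧
      FoxLaplacian.IsSumOfHermitianSquares
        (FoxLaplacian.steinbergLaplacian -
          lam • (1 : Matrix FoxLaplacian.Pairs FoxLaplacian.Pairs
            (MonoidAlgebra ℝ (Matrix.SpecialLinearGroup (Fin 3) ℤ)))) ∧
      ∀ (H : Type*) [NormedAddCommGroup H] [InnerProductSpace ℂ H] [CompleteSpace H]
        (π : Matrix.SpecialLinearGroup (Fin 3) ℤ →* unitary (H →L[ℂ] H)),
        IsUnit (FoxLaplacian.repMatrix π FoxLaplacian.steinbergLaplacian) ∧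
        spectrum ℂ (FoxLaplacian.repMatrix π FoxLaplacian.steinbergLaplacian) ⊆
          (fun t : ℝ => (t : ℂ)) '' Set.Ici lam := by
  have h := FoxLaplacian.isSumOfHermitianSquares_steinbergLaplacian_sub
    FoxLaplacian.reducedLaplacian_sub_mem_hermitianSquares
  exact ⟨0.32, by norm_num, le_rfl, h, fun H _ _ _ π =>
    FoxLaplacian.repMatrix_spectrum π (by norm_num) h⟩
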